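/- \textbf{Theorem.} A surface is a smooth immersion $X:U\to\mathbb R^4$ of a nonempty open set $U\subset\mathbb R^2$, with the induced metric and Levi-Civita connection $\nabla$. It has constant principal angles $\theta_1\le\theta_2$ with respect to a two-dimensional subspace $\Pi\subset\mathbb R^4$ if, for every $p\in U$, the tangent plane $T_p=dX_p(\mathbb R^2)$ and $\Pi$ have principal angles $\theta_1,\theta_2$. In that case $T_1$ and $T_2$ denote smooth unit tangent fields, defined on an open subset of $U$, with $S_pT_i=\cos^2(\theta_i)\,T_i$, where $S_p$ is the symmetric endomorphism of $T_p$ with $\langle S_pv,v'\rangle=\langle \mathrm{pr}_\Pi v,\mathrm{pr}_\Pi v'\rangle$; $T_i$ is geodesic if $\nabla_{T_i}T_i=0$ on its domain. The first normal space at $p$ is the span of the values of the second fundamental form at $p$. The surface is a composition (in the sense of Dajczer and do Carmo) if $X=F\circ g$ with $g:U\to W\subset\mathbb R^3$ smooth and isometric for the metric induced by $X$, $W$ open, and $F:W\to\mathbb R^4$ a smooth isometric immersion for the Euclidean metric of $W$. (1) For all $0<\theta_1<\theta_2<\frac{\pi}{2}$ there exist a two-dimensional subspace $\Pi\subset\mathbb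 R^4$ and an (embedded) surface $X:U\to\mathbb R^4$ with constant principal angles $\theta_1,\theta_2$ with respect to $\Pi$ whose first normal space has dimension $2$ at every point. (2) Let $0<\theta_1<\theta_2<\frac{\pi}{2}$ and let $X:U\to\mathbb R^4$ be any surface with constant principal angles $\theta_1,\theta_2$ with respect to a two-dimensional subspace $\Pi$ whose first normal space has dimension $2$ at every point. Then fields $T_1$ and $T_2$ exist in a neighbourhood of every point of $U$; on no nonempty open subset of $U$ is such a field $T_1$ or such a field $T_2$ geodesic; and the restriction of $X$ to a nonempty open subset of $U$ is never a composition. In particular, there exist surfaces in $\mathbb R^4$ with constant principal angles $0<\theta_1<\theta_2<\frac{\pi}{2}$ that are not compositions. -/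

import Mathlib

open scoped ContDiff RealInnerProductSpace

noncomputable section

/-- A parametrized immersed (smooth) surface `X : U → ℝ⁴`, `U ⊆ ℝ²` open and nonempty. -/
structure IsImmersedSurface (U : Set (EuclideanSpace ℝ (Fin 2)))
    (X : EuclideanSpace ℝ (Fin 2) → EuclideanSpace ℝ (Fin 4)) : Prop where
  isOpen : IsOpen U
  nonempty : U.Nonempty
  smooth : ContDiffOn ℝ ∞ X U
  immersion : ∀ p ∈ U, Function.Injective (fderiv ℝ X p)

/-- The tangent plane of the surface `X` at the parameter `p`, as a linear subspace of `ℝ⁴`. -/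
def tangentPlane (X : EuclideanSpace ℝ (Fin 2) → EuclideanSpace ℝ (Fin 4))
    (p : EuclideanSpace ℝ (Fin 2)) : Submodule ℝ (EuclideanSpace ℝ (Fin 4)) :=
  LinearMap.range (fderiv ℝ X p : EuclideanSpace ℝ (Fin 2) →ₗ[ℝ] EuclideanSpace ℝ (Fin 4))

/-- `0 ≤ θ₁ ≤ θ₂ ≤ π / 2` are the principal angles between the planes `V` and `W`:
`cos θ₁ = ⟪v₁, w₁⟫` is the maximum of `⟪v, w⟫` over unit vectors `v ∈ V`, `w ∈ W`, and `cos θ₂` is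
the maximum over those that are in addition orthogonal to `v₁` and `w₁` respectively. -/
def IsPrincipalAngles (V W : Submodule ℝ (EuclideanSpace ℝ (Fin 4))) (θ₁ θ₂ : ℝ) : Prop :=
  0 ≤ θ₁ ∧ θ₁ ≤ θ₂ ∧ θ₂ ≤ Real.pi / 2 ∧
    ∃ v₁ ∈ V, ∃ w₁ ∈ W, ‖v₁‖ = 1 ∧ ‖w₁‖ = 1 ∧ ⟪v₁, w₁⟫ = Real.cos θ₁ ∧
      IsGreatest {c : ℝ | ∃ v ∈ V, ∃ w ∈ W, ‖v‖ = 1 ∧ ‖w‖ = 1 ∧ ⟪v, w⟫ = c} (Real.cos θ₁) ∧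
      IsGreatest {c : ℝ | ∃ v ∈ V, ∃ w ∈ W, ‖v‖ = 1 ∧ ‖w‖ = 1 ∧ ⟪v, v₁⟫ = 0 ∧ ⟪w, w₁⟫ = 0 ∧
        ⟪v, w⟫ = c} (Real.cos θ₂)

/-- The surface `X : U → ℝ⁴` has constant principal angles `θ₁ ≤ θ₂` with respect to the
plane `P`. -/
def HasConstantPrincipalAngles (U : Set (EuclideanSpace ℝ (Fin 2)))
    (X : EuclideanSpace ℝ (Fin 2) → EuclideanSpace ℝ (Fin 4))
    (P : Submodule ℝ (EuclideanSpace ℝ (Fin 4))) (θ₁ θ₂ : ℝ) : Prop :=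
  Module.finrank ℝ P = 2 ∧ ∀ p ∈ U, IsPrincipalAngles (tangentPlane X p) P θ₁ θ₂

/-- The second fundamental form `α(dX a, dX b)`: the normal component of `D²X (a, b)`. -/
def secondFundamentalForm (X : EuclideanSpace ℝ (Fin 2) → EuclideanSpace ℝ (Fin 4))
    (p a b : EuclideanSpace ℝ (Fin 2)) : EuclideanSpace ℝ (Fin 4) :=
  (tangentPlane X p)ᗮ.starProjection (fderiv ℝ (fderiv ℝ X) p a b)

/-- The first normal space at `p`: the span of the values of the second fundamental form. -/
def firstNormalSpace (X : EuclideanSpace ℝ (Fin 2) → EuclideanSpace ℝ (Fin 4))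
    (p : EuclideanSpace ℝ (Fin 2)) : Submodule ℝ (EuclideanSpace ℝ (Fin 4)) :=
  Submodule.span ℝ {n | ∃ a b, n = secondFundamentalForm X p a b}

/-- The symmetric endomorphism of `V` that represents the quadratic form `v ↦ |p_W v|²`,
where `p_W` is the orthogonal projection onto `W`. -/
def angleOperator (W V : Submodule ℝ (EuclideanSpace ℝ (Fin 4))) : Module.End ℝ V :=
  (V.orthogonalProjectionOnto ∘L W.starProjection ∘L V.subtypeL : V →L[ℝ] V).toLinearMap

theorem inner_angleOperator (W V : Submodule ℝ (EuclideanSpace ℝ (Fin 4))) (v v' : V) :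
    ⟪angleOperator W V v, v'⟫ =
      ⟪W.starProjection (v : EuclideanSpace ℝ (Fin 4)), W.starProjection v'⟫ := by
  have h : ⟪angleOperator W V v, v'⟫ =
      ⟪W.starProjection (v : EuclideanSpace ℝ (Fin 4)), (v' : EuclideanSpace ℝ (Fin 4))⟫ := by
    simp [angleOperator]
  rw [h, Submodule.inner_starProjection_left_eq_right,
    Submodule.inner_starProjection_left_eq_right,
    Submodule.starProjection_eq_self_iff.2 (W.starProjection_apply_mem _)]

/-- `T` is a smooth unit tangent field of the surface `X` over `V` (a principal direction field)
that consists of eigenvectors of the operator `angleOperator P` for the eigenvalue `cos² θ`. -/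
def IsPrincipalField (V : Set (EuclideanSpace ℝ (Fin 2)))
    (X : EuclideanSpace ℝ (Fin 2) → EuclideanSpace ℝ (Fin 4))
    (P : Submodule ℝ (EuclideanSpace ℝ (Fin 4))) (θ : ℝ)
    (T : EuclideanSpace ℝ (Fin 2) → EuclideanSpace ℝ (Fin 4)) : Prop :=
  ContDiffOn ℝ ∞ T V ∧ ∀ p ∈ V, ‖T p‖ = 1 ∧ ∃ h : T p ∈ tangentPlane X p,
    (angleOperator P (tangentPlane X p)).HasEigenvector (Real.cos θ ^ 2) ⟨T p, h⟩

/-- The Levi-Civita derivative of the tangent field `T` in the direction `dX a` at `p`: the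
tangential component of the derivative in `ℝ⁴`. -/
def covariantDerivative (X T : EuclideanSpace ℝ (Fin 2) → EuclideanSpace ℝ (Fin 4))
    (p a : EuclideanSpace ℝ (Fin 2)) : EuclideanSpace ℝ (Fin 4) :=
  (tangentPlane X p).starProjection (fderiv ℝ T p a)

/-- The tangent field `T` is geodesic over `V`: `∇_T T = 0`. -/
def IsGeodesicField (V : Set (EuclideanSpace ℝ (Fin 2)))
    (X T : EuclideanSpace ℝ (Fin 2) → EuclideanSpace ℝ (Fin 4)) : Prop :=
  ∀ p ∈ V, ∀ a, fderiv ℝ X p a = T p → covariantDerivative X T p a = 0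

/-- The surface `X : U → ℝ⁴` is a composition in the sense of Dajczer and do Carmo: `X = F ∘ g`
with `g : U → W` isometric for the metric induced by `X` on `U` and the Euclidean metric of
the open set `W ⊆ ℝ³`, and `F : W → ℝ⁴` an isometric immersion. -/
def IsComposition (U : Set (EuclideanSpace ℝ (Fin 2)))
    (X : EuclideanSpace ℝ (Fin 2) → EuclideanSpace ℝ (Fin 4)) : Prop :=
  ∃ (W : Set (EuclideanSpace ℝ (Fin 3)))
    (g : EuclideanSpace ℝ (Fin 2) → EuclideanSpace ℝ (Fin 3))
    (F : EuclideanSpace ℝ (Fin 3) → EuclideanSpace ℝ (Fin 4)),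
    IsOpen W ∧ ContDiffOn ℝ ∞ g U ∧ Set.MapsTo g U W ∧
    (∀ p ∈ U, ∀ a b, ⟪fderiv ℝ g p a, fderiv ℝ g p b⟫ = ⟪fderiv ℝ X p a, fderiv ℝ X p b⟫) ∧
    ContDiffOn ℝ ∞ F W ∧
    (∀ q ∈ W, ∀ a b, ⟪fderiv ℝ F q a, fderiv ℝ F q b⟫ = ⟪a, b⟫) ∧
    Set.EqOn X (F ∘ g) U

end

/-! The plane field is split along `P` and its complement. With cᵢ = cos θᵢ and sᵢ = sin θᵢ, unit
principal fields are Tᵢ = cᵢeᵢ + sᵢnᵢ, where e₁, e₂ is an orthonormal frame of `P` and n₁, n₂ one of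
`Pᗮ`; the fields ξᵢ = -sᵢeᵢ + cᵢnᵢ then frame the normal bundle. Since `P` and `Pᗮ` are fixed, all
derivatives of the frame are encoded by two 1-forms: de₁ = A e₂ and dn₁ = B n₂.

The derivative of ξ₁ is orthogonal to T₁, and that of ξ₂ to T₂. Symmetry of D²X therefore leaves α =
m τ₂² ξ₁ + l τ₁² ξ₂, with τᵢ dual to Tᵢ (`inner_second_derivative_eq`), and makes A(Tᵢ) and B(Tᵢ)
proportional with a positive factor (`connection_relations`). The first normal space is a plane
exactly when l and m are nonzero. In that case A(Tᵢ) and B(Tᵢ) do not vanish and have equal signs,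
so neither the Levi-Civita form c₁c₂A + s₁s₂B nor the normal connection form s₁s₂A + c₁c₂B vanishes
on T₁ or T₂ (`connection_ne_zero`). The first of these facts says that no Tᵢ is geodesic.

If X = F ∘ g, let η = xξ₁ + yξ₂ be a unit normal of F. By the Gauss equation the second fundamental
form of F has rank at most one; restricted to the surface its determinant is xylm, so η is ±ξ₁ or
±ξ₂ (`normal_of_composition`). If ξ₁ is normal to F near a point, T₁ is null for the form of F,
hence in its kernel, and ξ₁ is parallel along T₁. The normal connection form forbids this, and
likewise with the indices exchanged (`not_isComposition`).

For existence, A and B are taken constant in coordinates satisfying the same relations; the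
resulting closed 1-form integrates to an explicit surface of exponential spirals (`spiralSurface`).
-/

section LinearAlgebra

/-! ### Orthonormal pairs and principal angles of planes -/

variable {E : Type*} [NormedAddCommGroup E] [InnerProductSpace ℝ E]

theorem Submodule.eq_add_of_orthonormal_pair {K : Submodule ℝ E} (hK : Module.finrank ℝ K = 2)
    {v w : E} (hv : v ∈ K) (hw : w ∈ K) (hvv : ⟪v, v⟫ = 1) (hww : ⟪w, w⟫ = 1) (hvw : ⟪v, w⟫ = 0)
    {x : E} (hx : x ∈ K) : x = ⟪x, v⟫ • v + ⟪x, w⟫ • w := by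
  have : FiniteDimensional ℝ K := Module.finite_of_finrank_pos (by omega)
  have hli : LinearIndependent ℝ ![v, w] := by
    rw [LinearIndependent.pair_iff]
    intro s t hst
    have h1 := congrArg (fun z => ⟪z, v⟫) hst
    have h2 := congrArg (fun z => ⟪z, w⟫) hst
    simp only [inner_add_left, real_inner_smul_left, inner_zero_left, hvv, hww, hvw,
      real_inner_comm v w] at h1 h2
    exact ⟨by linarith, by linarith⟩
  have hspan : Submodule.span ℝ (Set.range ![v, w]) = K := by
    apply Submodule.eq_of_le_of_finrank_eq
    · rw [Submodule.span_le]
      rintro _ ⟨i, rfl⟩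
      fin_cases i <;> simp [hv, hw]
    · rw [finrank_span_eq_card hli, hK, Fintype.card_fin]
  rw [← hspan, Matrix.range_cons, Matrix.range_cons, Matrix.range_empty, Set.union_empty,
    Set.singleton_union, Submodule.mem_span_pair] at hx
  obtain ⟨a, b, rfl⟩ := hx
  simp only [inner_add_left, real_inner_smul_left, hvv, hww, hvw, real_inner_comm v w]
  simp

theorem Submodule.starProjection_eq_of_orthonormal_pair {K : Submodule ℝ E}
    [K.HasOrthogonalProjection] (hK : Module.finrank ℝ K = 2)
    {v w : E} (hv : v ∈ K) (hw : w ∈ K) (hvv : ⟪v, v⟫ = 1) (hww : ⟪w, w⟫ = 1) (hvw : ⟪v, w⟫ = 0)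
    (x : E) : K.starProjection x = ⟪x, v⟫ • v + ⟪x, w⟫ • w := by
  rw [eq_add_of_orthonormal_pair hK hv hw hvv hww hvw (K.starProjection_apply_mem x),
    K.inner_starProjection_left_eq_right, K.inner_starProjection_left_eq_right,
    K.starProjection_eq_self_iff.2 hv, K.starProjection_eq_self_iff.2 hw]

theorem Submodule.eq_smul_of_unit {K : Submodule ℝ E} (hK : Module.finrank ℝ K = 1)
    {v : E} (hv : v ∈ K) (hvv : ⟪v, v⟫ = 1) {x : E} (hx : x ∈ K) : x = ⟪x, v⟫ • v := by
  have hne : (⟨v, hv⟩ : K) ≠ 0 := by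
    intro h
    have : v = 0 := congrArg Subtype.val h
    simp [this] at hvv
  obtain ⟨c, hc⟩ := (finrank_eq_one_iff_of_nonzero' _ hne).1 hK ⟨x, hx⟩
  have hc' : c • v = x := congrArg Subtype.val hc
  rw [← hc', real_inner_smul_left, hvv, mul_one]

theorem finrank_range_of_inner_eq {G : Type*} [NormedAddCommGroup G] [InnerProductSpace ℝ G]
    (L : G →L[ℝ] E) (hL : ∀ a b, ⟪L a, L b⟫ = ⟪a, b⟫) :
    Module.finrank ℝ (LinearMap.range (L : G →ₗ[ℝ] E)) = Module.finrank ℝ G := by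
  apply LinearMap.finrank_range_of_inj
  intro a b hab
  have h : ⟪L (a - b), L (a - b)⟫ = 0 := by
    have : L a = L b := hab
    rw [map_sub, this, sub_self, inner_zero_left]
  rw [hL, inner_self_eq_zero] at h
  exact sub_eq_zero.1 h

theorem hasEigenvector_angleOperator_iff {W V : Submodule ℝ (EuclideanSpace ℝ (Fin 4))} {c : ℝ}
    {v : EuclideanSpace ℝ (Fin 4)} (hv : v ∈ V) :
    (angleOperator W V).HasEigenvector c ⟨v, hv⟩ ↔
      V.starProjection (W.starProjection v) = c • v ∧ v ≠ 0 := by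
  rw [Module.End.hasEigenvector_iff, Module.End.mem_eigenspace_iff, Subtype.ext_iff, ne_eq,
    Submodule.mk_eq_zero]
  rfl

theorem inner_eq_zero_of_hasEigenvector {W V : Submodule ℝ (EuclideanSpace ℝ (Fin 4))} {c d : ℝ}
    (hcd : c ≠ d) {v w : V} (hv : (angleOperator W V).HasEigenvector c v)
    (hw : (angleOperator W V).HasEigenvector d w) :
    ⟪(v : EuclideanSpace ℝ (Fin 4)), w⟫ = 0 := by
  have h1 := inner_angleOperator W V v w
  have h2 := inner_angleOperator W V w v
  rw [hv.apply_eq_smul, real_inner_smul_left] at h1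
  rw [hw.apply_eq_smul, real_inner_smul_left, real_inner_comm, real_inner_comm (W.starProjection _),
    ← h1] at h2
  have h3 : (d - c) * ⟪v, w⟫ = 0 := by linarith
  exact (mul_eq_zero.1 h3).resolve_left (sub_ne_zero.2 hcd.symm)

/-- Mutually adapted orthonormal pairs that realize the principal angles of two planes. -/
theorem IsPrincipalAngles.exists_pairs {V W : Submodule ℝ (EuclideanSpace ℝ (Fin 4))} {θ₁ θ₂ : ℝ}
    (h : IsPrincipalAngles V W θ₁ θ₂) :
    ∃ v₁ ∈ V, ∃ v₂ ∈ V, ∃ w₁ ∈ W, ∃ w₂ ∈ W,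
      ⟪v₁, v₁⟫ = 1 ∧ ⟪v₂, v₂⟫ = 1 ∧ ⟪v₁, v₂⟫ = 0 ∧ ⟪w₁, w₁⟫ = 1 ∧ ⟪w₂, w₂⟫ = 1 ∧ ⟪w₁, w₂⟫ = 0 ∧
      ⟪v₁, w₁⟫ = Real.cos θ₁ ∧ ⟪v₂, w₂⟫ = Real.cos θ₂ ∧ ⟪v₁, w₂⟫ = 0 ∧ ⟪v₂, w₁⟫ = 0 := by
  obtain ⟨h0, h12, hpi, v₁, hv₁, w₁, hw₁, nv₁, nw₁, hvw, hmax, hmax₂⟩ := h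
  obtain ⟨v₂, hv₂, w₂, hw₂, nv₂, nw₂, ov, ow, hvw₂⟩ := hmax₂.1
  have sq : ∀ {v : EuclideanSpace ℝ (Fin 4)}, ‖v‖ = 1 → ⟪v, v⟫ = 1 := fun hv => by
    rw [real_inner_self_eq_norm_sq, hv, one_pow]
  have hc : 0 ≤ Real.cos θ₁ := Real.cos_nonneg_of_mem_Icc ⟨by linarith, by linarith⟩
  -- First variation of the maximum: if u had a component m along y, the normalized projection of u
  -- to the span of x and y would have inner product √(cos² θ₁ + m²) with u, beating the maximum cos
  -- θ₁.
  have key : ∀ {K : Submodule ℝ (EuclideanSpace ℝ (Fin 4))} {u x y : EuclideanSpace ℝ (Fin 4)},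
      x ∈ K → y ∈ K → ‖x‖ = 1 → ‖y‖ = 1 → ⟪y, x⟫ = 0 → ⟪u, x⟫ = Real.cos θ₁ →
      (∀ z ∈ K, ‖z‖ = 1 → ⟪u, z⟫ ≤ Real.cos θ₁) → ⟪u, y⟫ = 0 := by
    intro K u x y hx hy nx ny oxy hux hz
    set m := ⟪u, y⟫ with hm
    set z := Real.cos θ₁ • x + m • y with hzdef
    have hzz : ‖z‖ ^ 2 = Real.cos θ₁ ^ 2 + m ^ 2 := by
      rw [← real_inner_self_eq_norm_sq, hzdef]
      simp only [inner_add_left, inner_add_right, real_inner_smul_left, real_inner_smul_right,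
        sq nx, sq ny, oxy, real_inner_comm y x]
      ring
    have huz : ⟪u, z⟫ = ‖z‖ ^ 2 := by
      rw [hzz, hzdef, inner_add_right, real_inner_smul_right, real_inner_smul_right, hux, ← hm]
      ring
    by_contra hne
    have hpos : 0 < ‖z‖ ^ 2 := by rw [hzz]; positivity
    have hz0 : 0 < ‖z‖ := by
      rcases (norm_nonneg z).lt_or_eq with h | h
      · exact h
      · rw [← h] at hpos; norm_num at hpos
    have := hz (‖z‖⁻¹ • z) (K.smul_mem _ (K.add_mem (K.smul_mem _ hx) (K.smul_mem _ hy)))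
      (by rw [norm_smul, norm_inv, norm_norm, inv_mul_cancel₀ hz0.ne'])
    rw [real_inner_smul_right, huz, pow_two, inv_mul_cancel_left₀ hz0.ne'] at this
    have h2 : ‖z‖ ^ 2 ≤ Real.cos θ₁ ^ 2 := pow_le_pow_left₀ hz0.le this 2
    have : 0 < m ^ 2 := by positivity
    linarith
  refine ⟨v₁, hv₁, v₂, hv₂, w₁, hw₁, w₂, hw₂, sq nv₁, sq nv₂, by rw [real_inner_comm]; exact ov,
    sq nw₁, sq nw₂, by rw [real_inner_comm]; exact ow, hvw, hvw₂, ?_, ?_⟩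
  · exact key hw₁ hw₂ nw₁ nw₂ ow hvw fun z hz nz => hmax.2 ⟨v₁, hv₁, z, hz, nv₁, nz, rfl⟩
  · rw [real_inner_comm]
    refine key hv₁ hv₂ nv₁ nv₂ ov (by rw [real_inner_comm]; exact hvw) fun z hz nz => ?_
    rw [real_inner_comm]
    exact hmax.2 ⟨z, hz, w₁, hw₁, nz, nw₁, rfl⟩

/-- Mutually adapted orthonormal pairs of two planes determine their principal angles. -/
theorem isPrincipalAngles_of_pairs {V W : Submodule ℝ (EuclideanSpace ℝ (Fin 4))} {θ₁ θ₂ : ℝ}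
    (h0 : 0 ≤ θ₁) (h12 : θ₁ ≤ θ₂) (hpi : θ₂ ≤ Real.pi / 2)
    (hV : Module.finrank ℝ V = 2) (hW : Module.finrank ℝ W = 2)
    {v₁ v₂ w₁ w₂ : EuclideanSpace ℝ (Fin 4)} (hv₁ : v₁ ∈ V) (hv₂ : v₂ ∈ V) (hw₁ : w₁ ∈ W)
    (hw₂ : w₂ ∈ W) (nv₁ : ⟪v₁, v₁⟫ = 1) (nv₂ : ⟪v₂, v₂⟫ = 1) (ov : ⟪v₁, v₂⟫ = 0)
    (nw₁ : ⟪w₁, w₁⟫ = 1) (nw₂ : ⟪w₂, w₂⟫ = 1) (ow : ⟪w₁, w₂⟫ = 0)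
    (h11 : ⟪v₁, w₁⟫ = Real.cos θ₁) (h22 : ⟪v₂, w₂⟫ = Real.cos θ₂) (hvw₁ : ⟪v₁, w₂⟫ = 0)
    (hvw₂ : ⟪v₂, w₁⟫ = 0) : IsPrincipalAngles V W θ₁ θ₂ := by
  have sq : ∀ {v : EuclideanSpace ℝ (Fin 4)}, ⟪v, v⟫ = 1 ↔ ‖v‖ = 1 := fun {v} => by
    rw [real_inner_self_eq_norm_sq, pow_eq_one_iff_of_nonneg (norm_nonneg v) two_ne_zero]
  have hc2 : 0 ≤ Real.cos θ₂ := Real.cos_nonneg_of_mem_Icc ⟨by linarith, by linarith⟩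
  have hc12 : Real.cos θ₂ ≤ Real.cos θ₁ := Real.cos_le_cos_of_nonneg_of_le_pi h0 (by linarith) h12
  -- In the adapted bases the pairing of V and W is diagonal with entries cos θ₁ ≥ cos θ₂ ≥ 0, so
  -- both maxima reduce to 2ab ≤ a² + b².
  have expand : ∀ v ∈ V, ∀ w ∈ W,
      ⟪v, w⟫ = Real.cos θ₁ * (⟪v, v₁⟫ * ⟪w, w₁⟫) + Real.cos θ₂ * (⟪v, v₂⟫ * ⟪w, w₂⟫) := by
    intro v hv w hw
    conv_lhs => rw [Submodule.eq_add_of_orthonormal_pair hV hv₁ hv₂ nv₁ nv₂ ov hv,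
      Submodule.eq_add_of_orthonormal_pair hW hw₁ hw₂ nw₁ nw₂ ow hw]
    simp only [inner_add_left, inner_add_right, real_inner_smul_left, real_inner_smul_right,
      h11, h22, hvw₁, hvw₂]
    ring
  have pyth : ∀ {K : Submodule ℝ (EuclideanSpace ℝ (Fin 4))} {x y v},
      Module.finrank ℝ K = 2 → x ∈ K → y ∈ K → ⟪x, x⟫ = 1 → ⟪y, y⟫ = 1 → ⟪x, y⟫ = 0 → v ∈ K →
      ‖v‖ = 1 → ⟪v, x⟫ ^ 2 + ⟪v, y⟫ ^ 2 = 1 := by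
    intro K x y v hK hx hy nx ny oxy hv nv
    rw [← sq] at nv
    have e := congrArg (fun z => ⟪v, z⟫) (Submodule.eq_add_of_orthonormal_pair hK hx hy nx ny oxy hv)
    simp only [inner_add_right, real_inner_smul_right, nv] at e
    linarith
  refine ⟨h0, h12, hpi, v₁, hv₁, w₁, hw₁, sq.1 nv₁, sq.1 nw₁, h11,
    ⟨⟨v₁, hv₁, w₁, hw₁, sq.1 nv₁, sq.1 nw₁, h11⟩, ?_⟩,
    ⟨⟨v₂, hv₂, w₂, hw₂, sq.1 nv₂, sq.1 nw₂, by rw [real_inner_comm]; exact ov,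
      by rw [real_inner_comm]; exact ow, h22⟩, ?_⟩⟩
  · rintro _ ⟨v, hv, w, hw, nv, nw, rfl⟩
    have p1 := pyth hV hv₁ hv₂ nv₁ nv₂ ov hv nv
    have p2 := pyth hW hw₁ hw₂ nw₁ nw₂ ow hw nw
    rw [expand v hv w hw]
    generalize ⟪v, v₁⟫ = a at *
    generalize ⟪v, v₂⟫ = b at *
    generalize ⟪w, w₁⟫ = c at *
    generalize ⟪w, w₂⟫ = d at *
    have i1 : a * c ≤ (a ^ 2 + c ^ 2) / 2 := by nlinarith [sq_nonneg (a - c)]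
    have i2 : b * d ≤ (b ^ 2 + d ^ 2) / 2 := by nlinarith [sq_nonneg (b - d)]
    calc Real.cos θ₁ * (a * c) + Real.cos θ₂ * (b * d)
        ≤ Real.cos θ₁ * ((a ^ 2 + c ^ 2) / 2) + Real.cos θ₂ * ((b ^ 2 + d ^ 2) / 2) := by
          gcongr
          linarith
      _ ≤ Real.cos θ₁ * ((a ^ 2 + c ^ 2) / 2) + Real.cos θ₁ * ((b ^ 2 + d ^ 2) / 2) := by
          gcongr
      _ = Real.cos θ₁ * (((a ^ 2 + b ^ 2) + (c ^ 2 + d ^ 2)) / 2) := by ring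
      _ = Real.cos θ₁ := by rw [p1, p2]; ring
  · rintro _ ⟨v, hv, w, hw, nv, nw, ov', ow', rfl⟩
    have p1 := pyth hV hv₁ hv₂ nv₁ nv₂ ov hv nv
    have p2 := pyth hW hw₁ hw₂ nw₁ nw₂ ow hw nw
    rw [expand v hv w hw]
    rw [ov'] at p1 ⊢
    rw [ow'] at p2 ⊢
    generalize ⟪v, v₂⟫ = b at *
    generalize ⟪w, w₂⟫ = d at *
    have i2 : b * d ≤ 1 := by nlinarith [sq_nonneg (b - d)]
    calc Real.cos θ₁ * (0 * 0) + Real.cos θ₂ * (b * d) = Real.cos θ₂ * (b * d) := by ring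
      _ ≤ Real.cos θ₂ * 1 := by gcongr
      _ = Real.cos θ₂ := mul_one _

end LinearAlgebra

/-! ### Derivatives of orthonormal fields and of isometric maps -/

section Calculus

variable {E G : Type*} [NormedAddCommGroup E] [InnerProductSpace ℝ E]
  [NormedAddCommGroup G] [NormedSpace ℝ G]

theorem inner_fderiv_add_eq_zero_of_const {f g : G → E} {V : Set G} (hV : IsOpen V) {p : G}
    (hp : p ∈ V) (hf : DifferentiableAt ℝ f p) (hg : DifferentiableAt ℝ g p) {c : ℝ}
    (h : ∀ q ∈ V, ⟪f q, g q⟫ = c) (a : G) :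
    ⟪f p, fderiv ℝ g p a⟫ + ⟪fderiv ℝ f p a, g p⟫ = 0 := by
  rw [← fderiv_inner_apply ℝ hf hg]
  have : (fun q => ⟪f q, g q⟫) =ᶠ[nhds p] fun _ => c :=
    Filter.eventually_of_mem (hV.mem_nhds hp) h
  rw [this.fderiv_eq, fderiv_fun_const]
  rfl

/-- A field in a fixed subspace agrees with its own projection, and the projection commutes with
differentiation. -/
theorem fderiv_mem_of_forall_mem {K : Submodule ℝ E} [K.HasOrthogonalProjection] {f : G → E}
    {V : Set G} (hV : IsOpen V) {p : G} (hp : p ∈ V) (hf : DifferentiableAt ℝ f p)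
    (h : ∀ q ∈ V, f q ∈ K) (a : G) : fderiv ℝ f p a ∈ K := by
  have e : f =ᶠ[nhds p] fun q => K.starProjection (f q) :=
    Filter.eventually_of_mem (hV.mem_nhds hp) fun q hq => (K.starProjection_eq_self_iff.2 (h q hq)).symm
  have h2 : HasFDerivAt (fun q => K.starProjection (f q)) (K.starProjection ∘L fderiv ℝ f p) p :=
    K.starProjection.hasFDerivAt.comp p hf.hasFDerivAt
  rw [e.fderiv_eq, h2.fderiv]
  exact K.starProjection_apply_mem _

theorem ContDiffOn.differentiableAt_of_isOpen {F : Type*} [NormedAddCommGroup F] [NormedSpace ℝ F]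
    {f : G → F} {V : Set G} (hf : ContDiffOn ℝ ∞ f V) (hV : IsOpen V) {p : G} (hp : p ∈ V) :
    DifferentiableAt ℝ f p :=
  (hf.contDiffAt (hV.mem_nhds hp)).differentiableAt (by simp)

/-- `e₁, e₂` is a smooth orthonormal pair of fields over `V` with values in `K`. -/
structure IsOrthonormalPair (V : Set G) (K : Submodule ℝ E) (e₁ e₂ : G → E) : Prop where
  smooth₁ : ContDiffOn ℝ ∞ e₁ V
  smooth₂ : ContDiffOn ℝ ∞ e₂ V
  mem₁ : ∀ p ∈ V, e₁ p ∈ K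
  mem₂ : ∀ p ∈ V, e₂ p ∈ K
  unit₁ : ∀ p ∈ V, ⟪e₁ p, e₁ p⟫ = 1
  unit₂ : ∀ p ∈ V, ⟪e₂ p, e₂ p⟫ = 1
  orth : ∀ p ∈ V, ⟪e₁ p, e₂ p⟫ = 0

/-- The connection form of an orthonormal pair in a fixed plane. -/
theorem IsOrthonormalPair.exists_connection {V : Set G} {K : Submodule ℝ E}
    [K.HasOrthogonalProjection] {e₁ e₂ : G → E} (h : IsOrthonormalPair V K e₁ e₂)
    (hK : Module.finrank ℝ K = 2) (hV : IsOpen V) {p : G} (hp : p ∈ V) :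
    ∃ A : G → ℝ, ∀ a, fderiv ℝ e₁ p a = A a • e₂ p ∧ fderiv ℝ e₂ p a = -A a • e₁ p := by
  have d1 := h.smooth₁.differentiableAt_of_isOpen hV hp
  have d2 := h.smooth₂.differentiableAt_of_isOpen hV hp
  refine ⟨fun a => ⟪fderiv ℝ e₁ p a, e₂ p⟫, fun a => ?_⟩
  -- Differentiating the orthonormality relations makes the matrix of the derivative skew, so one
  -- form determines it.
  have i11 := inner_fderiv_add_eq_zero_of_const hV hp d1 d1 h.unit₁ a
  have i22 := inner_fderiv_add_eq_zero_of_const hV hp d2 d2 h.unit₂ a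
  have i12 := inner_fderiv_add_eq_zero_of_const hV hp d1 d2 h.orth a
  rw [real_inner_comm] at i11 i22
  rw [real_inner_comm (fderiv ℝ e₂ p a)] at i12
  have expand := fun x hx => Submodule.eq_add_of_orthonormal_pair (x := x) hK (h.mem₁ p hp)
    (h.mem₂ p hp) (h.unit₁ p hp) (h.unit₂ p hp) (h.orth p hp) hx
  constructor
  · rw [expand _ (fderiv_mem_of_forall_mem hV hp d1 h.mem₁ a)]
    have : ⟪fderiv ℝ e₁ p a, e₁ p⟫ = 0 := by linarith
    simp [this]
  · rw [expand (fderiv ℝ e₂ p a) (fderiv_mem_of_forall_mem hV hp d2 h.mem₂ a)]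
    have h0 : ⟪fderiv ℝ e₂ p a, e₂ p⟫ = 0 := by linarith
    have h1 : ⟪fderiv ℝ e₂ p a, e₁ p⟫ = -⟪fderiv ℝ e₁ p a, e₂ p⟫ := by linarith
    rw [h0, h1, zero_smul, add_zero]

theorem ContDiffOn.fderiv_smooth {F : Type*} [NormedAddCommGroup F] [NormedSpace ℝ F]
    {f : G → F} {V : Set G} (hf : ContDiffOn ℝ ∞ f V) (hV : IsOpen V) :
    ContDiffOn ℝ ∞ (fderiv ℝ f) V :=
  hf.fderiv_of_isOpen hV (by simp)

theorem ContDiffOn.fderiv_fderiv_comm {F : Type*} [NormedAddCommGroup F] [NormedSpace ℝ F]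
    {f : G → F} {V : Set G} (hf : ContDiffOn ℝ ∞ f V) (hV : IsOpen V) {p : G} (hp : p ∈ V)
    (a b : G) : fderiv ℝ (fderiv ℝ f) p a b = fderiv ℝ (fderiv ℝ f) p b a :=
  (hf.contDiffAt (hV.mem_nhds hp)).isSymmSndFDerivAt
    (by rw [minSmoothness_of_isRCLikeNormedField]; exact WithTop.coe_le_coe.2 le_top) a b

theorem ContDiffOn.hasFDerivAt_fderiv_apply {F : Type*} [NormedAddCommGroup F] [NormedSpace ℝ F]
    {f : G → F} {V : Set G} (hf : ContDiffOn ℝ ∞ f V) (hV : IsOpen V) {p : G} (hp : p ∈ V)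
    (b : G) : HasFDerivAt (fun q => fderiv ℝ f q b) ((fderiv ℝ (fderiv ℝ f) p).flip b) p := by
  have := ((hf.fderiv_smooth hV).differentiableAt_of_isOpen hV hp).hasFDerivAt
  exact this.clm_apply (hasFDerivAt_const b p) |>.congr_fderiv (by ext; simp)

/-- The second derivative of an isometric map is normal to the map. -/
theorem inner_fderiv_fderiv_of_isometric {H : Type*} [NormedAddCommGroup H]
    [InnerProductSpace ℝ H] {F : H → E} {W : Set H} (hF : ContDiffOn ℝ ∞ F W) (hW : IsOpen W)
    (hiso : ∀ q ∈ W, ∀ a b, ⟪fderiv ℝ F q a, fderiv ℝ F q b⟫ = ⟪a, b⟫) {q : H} (hq : q ∈ W)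
    (a b c : H) : ⟪fderiv ℝ (fderiv ℝ F) q a b, fderiv ℝ F q c⟫ = 0 := by
  have key : ∀ a b c, ⟪fderiv ℝ F q b, fderiv ℝ (fderiv ℝ F) q a c⟫ +
      ⟪fderiv ℝ (fderiv ℝ F) q a b, fderiv ℝ F q c⟫ = 0 := by
    intro a b c
    have hb := hF.hasFDerivAt_fderiv_apply hW hq b
    have hc := hF.hasFDerivAt_fderiv_apply hW hq c
    have := inner_fderiv_add_eq_zero_of_const hW hq hb.differentiableAt hc.differentiableAt
      (fun r hr => hiso r hr b c) a
    rwa [hb.fderiv, hc.fderiv] at this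
  -- As for the uniqueness of the Levi-Civita connection: three cyclic copies of the metric identity
  -- and the symmetry of D²F leave only the zero solution.
  have k1 := key a b c
  have k2 := key b c a
  have k3 := key c a b
  have s := fun x y => hF.fderiv_fderiv_comm hW hq x y
  rw [s b a, real_inner_comm] at k2
  rw [s c b, s c a, real_inner_comm] at k3
  rw [real_inner_comm] at k1
  linarith

/-- The Gauss equation of an isometric map of a flat space into a flat space. -/
theorem gauss_equation_of_isometric {H : Type*} [NormedAddCommGroup H]
    [InnerProductSpace ℝ H] {F : H → E} {W : Set H} (hF : ContDiffOn ℝ ∞ F W) (hW : IsOpen W)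
    (hiso : ∀ q ∈ W, ∀ a b, ⟪fderiv ℝ F q a, fderiv ℝ F q b⟫ = ⟪a, b⟫) {q : H} (hq : q ∈ W)
    (a b : H) : ⟪fderiv ℝ (fderiv ℝ F) q a a, fderiv ℝ (fderiv ℝ F) q b b⟫ =
      ⟪fderiv ℝ (fderiv ℝ F) q a b, fderiv ℝ (fderiv ℝ F) q a b⟫ := by
  have hF' := hF.fderiv_smooth hW
  have D : ∀ b c, HasFDerivAt (fun r => fderiv ℝ (fderiv ℝ F) r b c)
      (((fderiv ℝ (fderiv ℝ (fderiv ℝ F)) q).flip b).flip c) q := by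
    intro b c
    exact (hF'.hasFDerivAt_fderiv_apply hW hq b).clm_apply (hasFDerivAt_const c q)
      |>.congr_fderiv (by ext; simp)
  have key : ∀ a b c d, ⟪fderiv ℝ (fderiv ℝ F) q b c, fderiv ℝ (fderiv ℝ F) q a d⟫ +
      ⟪fderiv ℝ (fderiv ℝ (fderiv ℝ F)) q a b c, fderiv ℝ F q d⟫ = 0 := by
    intro a b c d
    have hd := hF.hasFDerivAt_fderiv_apply hW hq d
    have := inner_fderiv_add_eq_zero_of_const hW hq (D b c).differentiableAt hd.differentiableAt
      (fun r hr => inner_fderiv_fderiv_of_isometric hF hW hiso hr b c d) a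
    rwa [hd.fderiv, (D b c).fderiv] at this
  -- Both instances contain the same third-derivative term, because D³F is symmetric in its first
  -- two slots; subtracting them eliminates it.
  have k1 := key b a a b
  have k2 := key a b a b
  rw [hF'.fderiv_fderiv_comm hW hq b a] at k1
  rw [hF.fderiv_fderiv_comm hW hq b a] at k2
  linarith

end Calculus

/-! ### Adapted frames and their structure equations -/

section AdaptedFrame

/-- An orthonormal pair `e₁, e₂` of the plane `P` and an orthonormal pair `n₁, n₂` of `Pᗮ` such
that the fields `cos θᵢ • eᵢ + sin θᵢ • nᵢ` are tangent to the surface. -/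
structure IsAdaptedFrame (V : Set (EuclideanSpace ℝ (Fin 2)))
    (X : EuclideanSpace ℝ (Fin 2) → EuclideanSpace ℝ (Fin 4))
    (P : Submodule ℝ (EuclideanSpace ℝ (Fin 4))) (θ₁ θ₂ : ℝ)
    (e₁ e₂ n₁ n₂ : EuclideanSpace ℝ (Fin 2) → EuclideanSpace ℝ (Fin 4)) : Prop where
  isOpen : IsOpen V
  smooth : ContDiffOn ℝ ∞ X V
  immersion : ∀ p ∈ V, Function.Injective (fderiv ℝ X p)
  finrank_eq : Module.finrank ℝ P = 2
  base : IsOrthonormalPair V P e₁ e₂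
  fibre : IsOrthonormalPair V Pᗮ n₁ n₂
  tangent₁ : ∀ p ∈ V, Real.cos θ₁ • e₁ p + Real.sin θ₁ • n₁ p ∈ tangentPlane X p
  tangent₂ : ∀ p ∈ V, Real.cos θ₂ • e₂ p + Real.sin θ₂ • n₂ p ∈ tangentPlane X p

variable {V : Set (EuclideanSpace ℝ (Fin 2))}
  {X : EuclideanSpace ℝ (Fin 2) → EuclideanSpace ℝ (Fin 4)}
  {P : Submodule ℝ (EuclideanSpace ℝ (Fin 4))} {θ₁ θ₂ : ℝ}
  {e₁ e₂ n₁ n₂ : EuclideanSpace ℝ (Fin 2) → EuclideanSpace ℝ (Fin 4)}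
  {p : EuclideanSpace ℝ (Fin 2)}

theorem finrank_tangentPlane (h : Function.Injective (fderiv ℝ X p)) :
    Module.finrank ℝ (tangentPlane X p) = 2 := by
  rw [tangentPlane, LinearMap.finrank_range_of_inj h]
  simp

theorem finrank_orthogonal_eq_two {K : Submodule ℝ (EuclideanSpace ℝ (Fin 4))}
    (h : Module.finrank ℝ K = 2) : Module.finrank ℝ Kᗮ = 2 := by
  have := K.finrank_add_finrank_orthogonal
  rw [h, finrank_euclideanSpace_fin] at this
  omega

namespace IsAdaptedFrame

theorem orth_base_fibre (h : IsAdaptedFrame V X P θ₁ θ₂ e₁ e₂ n₁ n₂) (hp : p ∈ V) :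
    ⟪e₁ p, n₁ p⟫ = 0 ∧ ⟪e₁ p, n₂ p⟫ = 0 ∧ ⟪e₂ p, n₁ p⟫ = 0 ∧ ⟪e₂ p, n₂ p⟫ = 0 :=
  ⟨Submodule.inner_right_of_mem_orthogonal (h.base.mem₁ p hp) (h.fibre.mem₁ p hp),
    Submodule.inner_right_of_mem_orthogonal (h.base.mem₁ p hp) (h.fibre.mem₂ p hp),
    Submodule.inner_right_of_mem_orthogonal (h.base.mem₂ p hp) (h.fibre.mem₁ p hp),
    Submodule.inner_right_of_mem_orthogonal (h.base.mem₂ p hp) (h.fibre.mem₂ p hp)⟩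

/-- Inner products of linear combinations of the frame vectors. -/
theorem inner_combination (h : IsAdaptedFrame V X P θ₁ θ₂ e₁ e₂ n₁ n₂) (hp : p ∈ V)
    (a b c d a' b' c' d' : ℝ) :
    ⟪a • e₁ p + b • e₂ p + c • n₁ p + d • n₂ p, a' • e₁ p + b' • e₂ p + c' • n₁ p + d' • n₂ p⟫ =
      a * a' + b * b' + c * c' + d * d' := by
  obtain ⟨h1, h2, h3, h4⟩ := h.orth_base_fibre hp
  have h1' := h1; have h2' := h2; have h3' := h3; have h4' := h4
  have h5 := h.base.orth p hp
  have h6 := h.fibre.orth p hp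
  have h5' := h5; have h6' := h6
  rw [real_inner_comm] at h1' h2' h3' h4' h5' h6'
  simp only [inner_add_left, inner_add_right, real_inner_smul_left, real_inner_smul_right, h1, h2,
    h3, h4, h5, h6, h1', h2', h3', h4', h5', h6', h.base.unit₁ p hp, h.base.unit₂ p hp,
    h.fibre.unit₁ p hp, h.fibre.unit₂ p hp]
  ring

theorem inner_tangent (h : IsAdaptedFrame V X P θ₁ θ₂ e₁ e₂ n₁ n₂) (hp : p ∈ V) :
    ⟪Real.cos θ₁ • e₁ p + Real.sin θ₁ • n₁ p, Real.cos θ₁ • e₁ p + Real.sin θ₁ • n₁ p⟫ = 1 ∧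
      ⟪Real.cos θ₂ • e₂ p + Real.sin θ₂ • n₂ p, Real.cos θ₂ • e₂ p + Real.sin θ₂ • n₂ p⟫ = 1 ∧
      ⟪Real.cos θ₁ • e₁ p + Real.sin θ₁ • n₁ p, Real.cos θ₂ • e₂ p + Real.sin θ₂ • n₂ p⟫ = 0 := by
  have i := h.inner_combination hp
  refine ⟨?_, ?_, ?_⟩
  · have := i (Real.cos θ₁) 0 (Real.sin θ₁) 0 (Real.cos θ₁) 0 (Real.sin θ₁) 0
    simp only [zero_smul, add_zero] at this
    rw [this]; nlinarith [Real.sin_sq_add_cos_sq θ₁]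
  · have := i 0 (Real.cos θ₂) 0 (Real.sin θ₂) 0 (Real.cos θ₂) 0 (Real.sin θ₂)
    simp only [zero_smul, add_zero, zero_add] at this
    rw [this]; nlinarith [Real.sin_sq_add_cos_sq θ₂]
  · have := i (Real.cos θ₁) 0 (Real.sin θ₁) 0 0 (Real.cos θ₂) 0 (Real.sin θ₂)
    simp only [zero_smul, add_zero, zero_add] at this
    rw [this]; ring

theorem inner_normal (h : IsAdaptedFrame V X P θ₁ θ₂ e₁ e₂ n₁ n₂) (hp : p ∈ V) :
    ⟪-Real.sin θ₁ • e₁ p + Real.cos θ₁ • n₁ p, -Real.sin θ₁ • e₁ p + Real.cos θ₁ • n₁ p⟫ = 1 ∧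
      ⟪-Real.sin θ₂ • e₂ p + Real.cos θ₂ • n₂ p, -Real.sin θ₂ • e₂ p + Real.cos θ₂ • n₂ p⟫ = 1 ∧
      ⟪-Real.sin θ₁ • e₁ p + Real.cos θ₁ • n₁ p, -Real.sin θ₂ • e₂ p + Real.cos θ₂ • n₂ p⟫ = 0 := by
  have i := h.inner_combination hp
  refine ⟨?_, ?_, ?_⟩
  · have := i (-Real.sin θ₁) 0 (Real.cos θ₁) 0 (-Real.sin θ₁) 0 (Real.cos θ₁) 0
    simp only [zero_smul, add_zero] at this
    rw [this]; nlinarith [Real.sin_sq_add_cos_sq θ₁]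
  · have := i 0 (-Real.sin θ₂) 0 (Real.cos θ₂) 0 (-Real.sin θ₂) 0 (Real.cos θ₂)
    simp only [zero_smul, add_zero, zero_add] at this
    rw [this]; nlinarith [Real.sin_sq_add_cos_sq θ₂]
  · have := i (-Real.sin θ₁) 0 (Real.cos θ₁) 0 0 (-Real.sin θ₂) 0 (Real.cos θ₂)
    simp only [zero_smul, add_zero, zero_add] at this
    rw [this]; ring

theorem tangent_eq (h : IsAdaptedFrame V X P θ₁ θ₂ e₁ e₂ n₁ n₂) (hp : p ∈ V)
    (x : EuclideanSpace ℝ (Fin 4)) (hx : x ∈ tangentPlane X p) :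
    x = ⟪x, Real.cos θ₁ • e₁ p + Real.sin θ₁ • n₁ p⟫ • (Real.cos θ₁ • e₁ p + Real.sin θ₁ • n₁ p) +
      ⟪x, Real.cos θ₂ • e₂ p + Real.sin θ₂ • n₂ p⟫ •
        (Real.cos θ₂ • e₂ p + Real.sin θ₂ • n₂ p) := by
  obtain ⟨i1, i2, i3⟩ := h.inner_tangent hp
  exact Submodule.eq_add_of_orthonormal_pair (finrank_tangentPlane (h.immersion p hp))
    (h.tangent₁ p hp) (h.tangent₂ p hp) i1 i2 i3 hx

theorem normal₁ (h : IsAdaptedFrame V X P θ₁ θ₂ e₁ e₂ n₁ n₂) (hp : p ∈ V) :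
    -Real.sin θ₁ • e₁ p + Real.cos θ₁ • n₁ p ∈ (tangentPlane X p)ᗮ := by
  rw [Submodule.mem_orthogonal]
  intro x hx
  have i1 := h.inner_combination hp (Real.cos θ₁) 0 (Real.sin θ₁) 0 (-Real.sin θ₁) 0 (Real.cos θ₁) 0
  have i2 := h.inner_combination hp 0 (Real.cos θ₂) 0 (Real.sin θ₂) (-Real.sin θ₁) 0 (Real.cos θ₁) 0
  simp only [zero_smul, add_zero, zero_add] at i1 i2
  rw [h.tangent_eq hp x hx, inner_add_left, real_inner_smul_left, real_inner_smul_left, i1, i2]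
  ring

theorem normal₂ (h : IsAdaptedFrame V X P θ₁ θ₂ e₁ e₂ n₁ n₂) (hp : p ∈ V) :
    -Real.sin θ₂ • e₂ p + Real.cos θ₂ • n₂ p ∈ (tangentPlane X p)ᗮ := by
  rw [Submodule.mem_orthogonal]
  intro x hx
  have i1 := h.inner_combination hp (Real.cos θ₁) 0 (Real.sin θ₁) 0 0 (-Real.sin θ₂) 0 (Real.cos θ₂)
  have i2 := h.inner_combination hp 0 (Real.cos θ₂) 0 (Real.sin θ₂) 0 (-Real.sin θ₂) 0 (Real.cos θ₂)
  simp only [zero_smul, add_zero, zero_add] at i1 i2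
  rw [h.tangent_eq hp x hx, inner_add_left, real_inner_smul_left, real_inner_smul_left, i1, i2]
  ring

theorem normal_eq (h : IsAdaptedFrame V X P θ₁ θ₂ e₁ e₂ n₁ n₂) (hp : p ∈ V)
    (x : EuclideanSpace ℝ (Fin 4)) (hx : x ∈ (tangentPlane X p)ᗮ) :
    x = ⟪x, -Real.sin θ₁ • e₁ p + Real.cos θ₁ • n₁ p⟫ •
        (-Real.sin θ₁ • e₁ p + Real.cos θ₁ • n₁ p) +
      ⟪x, -Real.sin θ₂ • e₂ p + Real.cos θ₂ • n₂ p⟫ •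
        (-Real.sin θ₂ • e₂ p + Real.cos θ₂ • n₂ p) := by
  obtain ⟨i1, i2, i3⟩ := h.inner_normal hp
  exact Submodule.eq_add_of_orthonormal_pair
    (finrank_orthogonal_eq_two (finrank_tangentPlane (h.immersion p hp)))
    (h.normal₁ hp) (h.normal₂ hp) i1 i2 i3 hx

/-- The Weingarten relation, obtained by differentiating the orthogonality of dX(b) and ξ. -/
theorem inner_second_derivative {ξ : EuclideanSpace ℝ (Fin 2) → EuclideanSpace ℝ (Fin 4)}
    (hV : IsOpen V) (hX : ContDiffOn ℝ ∞ X V) (hp : p ∈ V) (hξ : DifferentiableAt ℝ ξ p)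
    (hn : ∀ q ∈ V, ξ q ∈ (tangentPlane X q)ᗮ) (a b : EuclideanSpace ℝ (Fin 2)) :
    ⟪fderiv ℝ (fderiv ℝ X) p a b, ξ p⟫ = -⟪fderiv ℝ X p b, fderiv ℝ ξ p a⟫ := by
  have hb := hX.hasFDerivAt_fderiv_apply hV hp b
  have := inner_fderiv_add_eq_zero_of_const hV hp hb.differentiableAt hξ (c := 0)
    (fun q hq => Submodule.inner_right_of_mem_orthogonal (LinearMap.mem_range_self _ b) (hn q hq)) a
  rw [hb.fderiv] at this
  simp only [ContinuousLinearMap.flip_apply] at this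
  linarith

theorem inner_secondFundamentalForm {n : EuclideanSpace ℝ (Fin 4)}
    (hn : n ∈ (tangentPlane X p)ᗮ) (a b : EuclideanSpace ℝ (Fin 2)) :
    ⟪secondFundamentalForm X p a b, n⟫ = ⟪fderiv ℝ (fderiv ℝ X) p a b, n⟫ := by
  rw [secondFundamentalForm, Submodule.inner_starProjection_left_eq_right,
    Submodule.starProjection_eq_self_iff.2 hn]

theorem hasFDerivAt_combination {E G : Type*} [NormedAddCommGroup E] [NormedSpace ℝ E]
    [NormedAddCommGroup G] [NormedSpace ℝ G] {f g : G → E} {q : G}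
    (hf : DifferentiableAt ℝ f q) (hg : DifferentiableAt ℝ g q) (x y : ℝ) :
    HasFDerivAt (fun r => x • f r + y • g r) (x • fderiv ℝ f q + y • fderiv ℝ g q) q :=
  (hf.hasFDerivAt.const_smul x).add (hg.hasFDerivAt.const_smul y)

/-- The structure equations of an adapted frame. -/
theorem exists_connection (h : IsAdaptedFrame V X P θ₁ θ₂ e₁ e₂ n₁ n₂) (hp : p ∈ V) :
    ∃ A B : EuclideanSpace ℝ (Fin 2) → ℝ,
      (∀ a, fderiv ℝ e₁ p a = A a • e₂ p ∧ fderiv ℝ e₂ p a = -A a • e₁ p) ∧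
      (∀ a, fderiv ℝ n₁ p a = B a • n₂ p ∧ fderiv ℝ n₂ p a = -B a • n₁ p) := by
  obtain ⟨A, hA⟩ := h.base.exists_connection h.finrank_eq h.isOpen hp
  obtain ⟨B, hB⟩ := h.fibre.exists_connection (finrank_orthogonal_eq_two h.finrank_eq) h.isOpen hp
  exact ⟨A, B, hA, hB⟩

theorem differentiableAt (h : IsAdaptedFrame V X P θ₁ θ₂ e₁ e₂ n₁ n₂) (hp : p ∈ V) :
    DifferentiableAt ℝ e₁ p ∧ DifferentiableAt ℝ e₂ p ∧ DifferentiableAt ℝ n₁ p ∧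
      DifferentiableAt ℝ n₂ p :=
  ⟨h.base.smooth₁.differentiableAt_of_isOpen h.isOpen hp,
    h.base.smooth₂.differentiableAt_of_isOpen h.isOpen hp,
    h.fibre.smooth₁.differentiableAt_of_isOpen h.isOpen hp,
    h.fibre.smooth₂.differentiableAt_of_isOpen h.isOpen hp⟩

/-- The components of the second fundamental form in an adapted frame. -/
theorem inner_second_derivative_normal (h : IsAdaptedFrame V X P θ₁ θ₂ e₁ e₂ n₁ n₂) (hp : p ∈ V)
    {A B : EuclideanSpace ℝ (Fin 2) → ℝ}
    (hA : ∀ a, fderiv ℝ e₁ p a = A a • e₂ p ∧ fderiv ℝ e₂ p a = -A a • e₁ p)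
    (hB : ∀ a, fderiv ℝ n₁ p a = B a • n₂ p ∧ fderiv ℝ n₂ p a = -B a • n₁ p)
    {t : EuclideanSpace ℝ (Fin 2)} {x y : ℝ}
    (ht : fderiv ℝ X p t = x • (Real.cos θ₁ • e₁ p + Real.sin θ₁ • n₁ p) +
      y • (Real.cos θ₂ • e₂ p + Real.sin θ₂ • n₂ p)) (a : EuclideanSpace ℝ (Fin 2)) :
    ⟪fderiv ℝ (fderiv ℝ X) p a t, -Real.sin θ₁ • e₁ p + Real.cos θ₁ • n₁ p⟫ =
        y * (Real.sin θ₁ * Real.cos θ₂ * A a - Real.cos θ₁ * Real.sin θ₂ * B a) ∧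
      ⟪fderiv ℝ (fderiv ℝ X) p a t, -Real.sin θ₂ • e₂ p + Real.cos θ₂ • n₂ p⟫ =
        x * (Real.sin θ₁ * Real.cos θ₂ * B a - Real.cos θ₁ * Real.sin θ₂ * A a) := by
  obtain ⟨d1, d2, d3, d4⟩ := h.differentiableAt hp
  constructor
  · rw [inner_second_derivative h.isOpen h.smooth hp (ξ := fun q => _ • e₁ q + _ • n₁ q)
      (hasFDerivAt_combination d1 d3 _ _).differentiableAt (fun q hq => h.normal₁ hq),
      (hasFDerivAt_combination d1 d3 _ _).fderiv, add_apply,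
      smul_apply, smul_apply, ht, (hA a).1, (hB a).1]
    have := h.inner_combination hp (x * Real.cos θ₁) (y * Real.cos θ₂) (x * Real.sin θ₁)
      (y * Real.sin θ₂) 0 (-Real.sin θ₁ * A a) 0 (Real.cos θ₁ * B a)
    rw [show x • (Real.cos θ₁ • e₁ p + Real.sin θ₁ • n₁ p) +
      y • (Real.cos θ₂ • e₂ p + Real.sin θ₂ • n₂ p) = (x * Real.cos θ₁) • e₁ p +
      (y * Real.cos θ₂) • e₂ p + (x * Real.sin θ₁) • n₁ p + (y * Real.sin θ₂) • n₂ p by module,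
      show -Real.sin θ₁ • A a • e₂ p + Real.cos θ₁ • B a • n₂ p = (0 : ℝ) • e₁ p +
      (-Real.sin θ₁ * A a) • e₂ p + (0 : ℝ) • n₁ p + (Real.cos θ₁ * B a) • n₂ p by module, this]
    ring
  · rw [inner_second_derivative h.isOpen h.smooth hp (ξ := fun q => _ • e₂ q + _ • n₂ q)
      (hasFDerivAt_combination d2 d4 _ _).differentiableAt (fun q hq => h.normal₂ hq),
      (hasFDerivAt_combination d2 d4 _ _).fderiv, add_apply,
      smul_apply, smul_apply, ht, (hA a).2, (hB a).2]
    have := h.inner_combination hp (x * Real.cos θ₁) (y * Real.cos θ₂) (x * Real.sin θ₁)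
      (y * Real.sin θ₂) (Real.sin θ₂ * A a) 0 (-Real.cos θ₂ * B a) 0
    rw [show x • (Real.cos θ₁ • e₁ p + Real.sin θ₁ • n₁ p) +
      y • (Real.cos θ₂ • e₂ p + Real.sin θ₂ • n₂ p) = (x * Real.cos θ₁) • e₁ p +
      (y * Real.cos θ₂) • e₂ p + (x * Real.sin θ₁) • n₁ p + (y * Real.sin θ₂) • n₂ p by module,
      show -Real.sin θ₂ • -A a • e₁ p + Real.cos θ₂ • -B a • n₁ p = (Real.sin θ₂ * A a) • e₁ p +
      (0 : ℝ) • e₂ p + (-Real.cos θ₂ * B a) • n₁ p + (0 : ℝ) • n₂ p by module, this]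
    ring

end IsAdaptedFrame

end AdaptedFrame

/-! ### The second fundamental form in an adapted frame -/

section AdaptedFrame

variable {V : Set (EuclideanSpace ℝ (Fin 2))}
  {X : EuclideanSpace ℝ (Fin 2) → EuclideanSpace ℝ (Fin 4)}
  {P : Submodule ℝ (EuclideanSpace ℝ (Fin 4))} {θ₁ θ₂ : ℝ}
  {e₁ e₂ n₁ n₂ : EuclideanSpace ℝ (Fin 2) → EuclideanSpace ℝ (Fin 4)}
  {p : EuclideanSpace ℝ (Fin 2)}

namespace IsAdaptedFrame

theorem exists_coordinates (h : IsAdaptedFrame V X P θ₁ θ₂ e₁ e₂ n₁ n₂) (hp : p ∈ V) :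
    ∃ t₁ t₂, fderiv ℝ X p t₁ = Real.cos θ₁ • e₁ p + Real.sin θ₁ • n₁ p ∧
      fderiv ℝ X p t₂ = Real.cos θ₂ • e₂ p + Real.sin θ₂ • n₂ p := by
  obtain ⟨t₁, ht₁⟩ := h.tangent₁ p hp
  obtain ⟨t₂, ht₂⟩ := h.tangent₂ p hp
  exact ⟨t₁, t₂, ht₁, ht₂⟩

section

variable (h : IsAdaptedFrame V X P θ₁ θ₂ e₁ e₂ n₁ n₂) (hp : p ∈ V)
  {A B : EuclideanSpace ℝ (Fin 2) → ℝ}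
  (hA : ∀ a, fderiv ℝ e₁ p a = A a • e₂ p ∧ fderiv ℝ e₂ p a = -A a • e₁ p)
  (hB : ∀ a, fderiv ℝ n₁ p a = B a • n₂ p ∧ fderiv ℝ n₂ p a = -B a • n₁ p)
  {t₁ t₂ : EuclideanSpace ℝ (Fin 2)}
  (ht₁ : fderiv ℝ X p t₁ = Real.cos θ₁ • e₁ p + Real.sin θ₁ • n₁ p)
  (ht₂ : fderiv ℝ X p t₂ = Real.cos θ₂ • e₂ p + Real.sin θ₂ • n₂ p)

include h hp hA hB ht₁ ht₂

/-- The Codazzi relations between the connection forms. -/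
theorem connection_relations :
    Real.sin θ₁ * Real.cos θ₂ * A t₁ = Real.cos θ₁ * Real.sin θ₂ * B t₁ ∧
      Real.cos θ₁ * Real.sin θ₂ * A t₂ = Real.sin θ₁ * Real.cos θ₂ * B t₂ := by
  have i1 := h.inner_second_derivative_normal hp hA hB (t := t₁) (x := 1) (y := 0)
    (by rw [ht₁]; module)
  have i2 := h.inner_second_derivative_normal hp hA hB (t := t₂) (x := 0) (y := 1)
    (by rw [ht₂]; module)
  have a1 := (i1 t₂).1
  have a2 := (i2 t₁).1
  have b1 := (i1 t₂).2
  have b2 := (i2 t₁).2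
  -- The mixed terms D²X(t₁, t₂) and D²X(t₂, t₁) are computed by different formulas, one of which is
  -- zero; equating them gives each relation.
  rw [h.smooth.fderiv_fderiv_comm h.isOpen hp] at a2 b2
  rw [a1] at a2
  rw [b1] at b2
  constructor <;> linarith

/-- The component along ξ₁ ignores the T₁-part of its second argument because dξ₁ is orthogonal to
T₁; by symmetry it ignores that of the first too, leaving a multiple of τ₂². The component along ξ₂
is treated alike. -/
theorem inner_second_derivative_eq (a b : EuclideanSpace ℝ (Fin 2)) :
    ⟪fderiv ℝ (fderiv ℝ X) p a b, -Real.sin θ₁ • e₁ p + Real.cos θ₁ • n₁ p⟫ =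
        ⟪fderiv ℝ X p a, Real.cos θ₂ • e₂ p + Real.sin θ₂ • n₂ p⟫ *
        ⟪fderiv ℝ X p b, Real.cos θ₂ • e₂ p + Real.sin θ₂ • n₂ p⟫ *
        (Real.sin θ₁ * Real.cos θ₂ * A t₂ - Real.cos θ₁ * Real.sin θ₂ * B t₂) ∧
      ⟪fderiv ℝ (fderiv ℝ X) p a b, -Real.sin θ₂ • e₂ p + Real.cos θ₂ • n₂ p⟫ =
        ⟪fderiv ℝ X p a, Real.cos θ₁ • e₁ p + Real.sin θ₁ • n₁ p⟫ *
        ⟪fderiv ℝ X p b, Real.cos θ₁ • e₁ p + Real.sin θ₁ • n₁ p⟫ *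
        (Real.sin θ₁ * Real.cos θ₂ * B t₁ - Real.cos θ₁ * Real.sin θ₂ * A t₁) := by
  have i := fun c => h.inner_second_derivative_normal hp hA hB
    (h.tangent_eq hp (fderiv ℝ X p c) (LinearMap.mem_range_self _ c))
  have i1 := h.inner_second_derivative_normal hp hA hB (t := t₁) (x := 1) (y := 0)
    (by rw [ht₁]; module)
  have i2 := h.inner_second_derivative_normal hp hA hB (t := t₂) (x := 0) (y := 1)
    (by rw [ht₂]; module)
  have s := fun x y => h.smooth.fderiv_fderiv_comm h.isOpen hp x y
  constructor
  · have e := (i2 a).1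
    rw [s a t₂, (i a t₂).1] at e
    rw [(i b a).1]
    linear_combination (-⟪fderiv ℝ X p b, Real.cos θ₂ • e₂ p + Real.sin θ₂ • n₂ p⟫) * e
  · have e := (i1 a).2
    rw [s a t₁, (i a t₁).2] at e
    rw [(i b a).2]
    linear_combination (-⟪fderiv ℝ X p b, Real.cos θ₁ • e₁ p + Real.sin θ₁ • n₁ p⟫) * e

/-- The values α(T₁, T₁) and α(T₂, T₂) are multiples, by the two coefficients, of the two
orthonormal normals, and α(T₁, T₂) = 0. A vanishing coefficient confines α to a line. -/
theorem finrank_firstNormalSpace_eq_two_iff :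
    Module.finrank ℝ (firstNormalSpace X p) = 2 ↔
      Real.sin θ₁ * Real.cos θ₂ * B t₁ - Real.cos θ₁ * Real.sin θ₂ * A t₁ ≠ 0 ∧
      Real.sin θ₁ * Real.cos θ₂ * A t₂ - Real.cos θ₁ * Real.sin θ₂ * B t₂ ≠ 0 := by
  have eq := h.inner_second_derivative_eq hp hA hB ht₁ ht₂
  set l := Real.sin θ₁ * Real.cos θ₂ * B t₁ - Real.cos θ₁ * Real.sin θ₂ * A t₁
  set m := Real.sin θ₁ * Real.cos θ₂ * A t₂ - Real.cos θ₁ * Real.sin θ₂ * B t₂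
  have hmem : ∀ a b, secondFundamentalForm X p a b ∈ (tangentPlane X p)ᗮ := fun a b =>
    Submodule.starProjection_apply_mem _ _
  have expand : ∀ a b, secondFundamentalForm X p a b =
      (⟪fderiv ℝ X p a, Real.cos θ₂ • e₂ p + Real.sin θ₂ • n₂ p⟫ *
        ⟪fderiv ℝ X p b, Real.cos θ₂ • e₂ p + Real.sin θ₂ • n₂ p⟫ * m) •
        (-Real.sin θ₁ • e₁ p + Real.cos θ₁ • n₁ p) +
      (⟪fderiv ℝ X p a, Real.cos θ₁ • e₁ p + Real.sin θ₁ • n₁ p⟫ *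
        ⟪fderiv ℝ X p b, Real.cos θ₁ • e₁ p + Real.sin θ₁ • n₁ p⟫ * l) •
        (-Real.sin θ₂ • e₂ p + Real.cos θ₂ • n₂ p) := by
    intro a b
    rw [← (eq a b).1, ← (eq a b).2, ← inner_secondFundamentalForm (h.normal₁ hp),
      ← inner_secondFundamentalForm (h.normal₂ hp)]
    exact h.normal_eq hp _ (hmem a b)
  have one : ∀ n : EuclideanSpace ℝ (Fin 4),
      (∀ a b, secondFundamentalForm X p a b ∈ Submodule.span ℝ {n}) →
      Module.finrank ℝ (firstNormalSpace X p) ≠ 2 := by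
    intro n hn h2
    have hle : firstNormalSpace X p ≤ Submodule.span ℝ {n} := by
      rw [firstNormalSpace, Submodule.span_le]
      rintro _ ⟨a, b, rfl⟩
      exact hn a b
    have h1 := Submodule.finrank_mono hle
    have h3 := finrank_span_le_card (R := ℝ) ({n} : Set (EuclideanSpace ℝ (Fin 4)))
    simp only [Set.toFinset_singleton, Finset.card_singleton] at h3
    omega
  constructor
  · intro h2
    constructor
    · intro hl
      refine one (-Real.sin θ₁ • e₁ p + Real.cos θ₁ • n₁ p) (fun a b => ?_) h2
      rw [expand, hl, mul_zero, zero_smul, add_zero]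
      exact Submodule.smul_mem _ _ (Submodule.mem_span_singleton_self _)
    · intro hm
      refine one (-Real.sin θ₂ • e₂ p + Real.cos θ₂ • n₂ p) (fun a b => ?_) h2
      rw [expand, hm, mul_zero, zero_smul, zero_add]
      exact Submodule.smul_mem _ _ (Submodule.mem_span_singleton_self _)
  · rintro ⟨hl, hm⟩
    obtain ⟨i1, i2, i3⟩ := h.inner_tangent hp
    have i4 := i3
    rw [real_inner_comm] at i4
    have x1 := expand t₁ t₁
    have x2 := expand t₂ t₂
    rw [ht₁, i1, i3] at x1
    rw [ht₂, i2, i4] at x2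
    have m1 : -Real.sin θ₂ • e₂ p + Real.cos θ₂ • n₂ p ∈ firstNormalSpace X p := by
      have : -Real.sin θ₂ • e₂ p + Real.cos θ₂ • n₂ p = l⁻¹ • secondFundamentalForm X p t₁ t₁ := by
        rw [x1, zero_mul, zero_mul, zero_smul, zero_add, one_mul, one_mul, smul_smul,
          inv_mul_cancel₀ hl, one_smul]
      rw [this]
      exact Submodule.smul_mem _ _ (Submodule.subset_span ⟨t₁, t₁, rfl⟩)
    have m2 : -Real.sin θ₁ • e₁ p + Real.cos θ₁ • n₁ p ∈ firstNormalSpace X p := by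
      have : -Real.sin θ₁ • e₁ p + Real.cos θ₁ • n₁ p = m⁻¹ • secondFundamentalForm X p t₂ t₂ := by
        rw [x2, zero_mul, zero_mul, zero_smul, add_zero, one_mul, one_mul, smul_smul,
          inv_mul_cancel₀ hm, one_smul]
      rw [this]
      exact Submodule.smul_mem _ _ (Submodule.subset_span ⟨t₂, t₂, rfl⟩)
    have : firstNormalSpace X p = (tangentPlane X p)ᗮ := by
      apply le_antisymm
      · rw [firstNormalSpace, Submodule.span_le]
        rintro _ ⟨a, b, rfl⟩
        exact hmem a b
      · intro x hx
        rw [h.normal_eq hp x hx]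
        exact Submodule.add_mem _ (Submodule.smul_mem _ _ m2) (Submodule.smul_mem _ _ m1)
    rw [this]
    exact finrank_orthogonal_eq_two (finrank_tangentPlane (h.immersion p hp))

end

/-- Nonvanishing of the Levi-Civita and normal connection forms. -/
theorem connection_ne_zero {s₁ c₁ s₂ c₂ a b : ℝ} (hs₁ : 0 < s₁) (hc₁ : 0 < c₁)
    (hs₂ : 0 < s₂) (hc₂ : 0 < c₂) (hab : s₁ * c₂ * a = c₁ * s₂ * b)
    (hne : s₁ * c₂ * b - c₁ * s₂ * a ≠ 0) :
    c₁ * c₂ * a + s₁ * s₂ * b ≠ 0 ∧ s₁ * s₂ * a + c₁ * c₂ * b ≠ 0 := by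
  -- The relation makes b a positive multiple of a, so a sum of a and b with positive weights is a
  -- nonzero multiple of a.
  have hb : b = s₁ * c₂ * a / (c₁ * s₂) := by
    field_simp
    linarith
  have ha : a ≠ 0 := by
    rintro rfl
    apply hne
    rw [hb]
    ring
  constructor
  · have : c₁ * c₂ * a + s₁ * s₂ * b = a * (c₁ * c₂ + s₁ * s₂ * (s₁ * c₂ / (c₁ * s₂))) := by
      rw [hb]; ring
    rw [this]
    exact mul_ne_zero ha (by positivity)
  · have : s₁ * s₂ * a + c₁ * c₂ * b = a * (s₁ * s₂ + c₁ * c₂ * (s₁ * c₂ / (c₁ * s₂))) := by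
      rw [hb]; ring
    rw [this]
    exact mul_ne_zero ha (by positivity)

end IsAdaptedFrame

end AdaptedFrame

/-! ### Surfaces inside flat hypersurfaces -/

section Composition

variable {V : Set (EuclideanSpace ℝ (Fin 2))}
  {X : EuclideanSpace ℝ (Fin 2) → EuclideanSpace ℝ (Fin 4)}
  {W : Set (EuclideanSpace ℝ (Fin 3))}
  {g : EuclideanSpace ℝ (Fin 2) → EuclideanSpace ℝ (Fin 3)}
  {F : EuclideanSpace ℝ (Fin 3) → EuclideanSpace ℝ (Fin 4)} {p : EuclideanSpace ℝ (Fin 2)}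

theorem fderiv_of_eqOn_comp (hV : IsOpen V) (hW : IsOpen W) (hg : ContDiffOn ℝ ∞ g V)
    (hgW : Set.MapsTo g V W) (hF : ContDiffOn ℝ ∞ F W) (hX : Set.EqOn X (F ∘ g) V) (hp : p ∈ V) :
    fderiv ℝ X p = fderiv ℝ F (g p) ∘L fderiv ℝ g p := by
  have : X =ᶠ[nhds p] F ∘ g := Filter.eventually_of_mem (hV.mem_nhds hp) hX
  rw [this.fderiv_eq]
  exact fderiv_comp p (hF.differentiableAt_of_isOpen hW (hgW hp))
    (hg.differentiableAt_of_isOpen hV hp)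

/-- In the chain rule for D²(F ∘ g) the term DF(D²g) is tangent to F and disappears against the
normal η. -/
theorem inner_fderiv_fderiv_of_eqOn_comp (hV : IsOpen V) (hW : IsOpen W)
    (hg : ContDiffOn ℝ ∞ g V) (hgW : Set.MapsTo g V W) (hF : ContDiffOn ℝ ∞ F W)
    (hX : Set.EqOn X (F ∘ g) V) (hXs : ContDiffOn ℝ ∞ X V) (hp : p ∈ V)
    {η : EuclideanSpace ℝ (Fin 4)} (hη : ∀ w, ⟪η, fderiv ℝ F (g p) w⟫ = 0)
    (a b : EuclideanSpace ℝ (Fin 2)) :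
    ⟪fderiv ℝ (fderiv ℝ X) p a b, η⟫ =
      ⟪fderiv ℝ (fderiv ℝ F) (g p) (fderiv ℝ g p a) (fderiv ℝ g p b), η⟫ := by
  have e : (fun q => fderiv ℝ X q b) =ᶠ[nhds p] fun q => fderiv ℝ F (g q) (fderiv ℝ g q b) :=
    Filter.eventually_of_mem (hV.mem_nhds hp) fun q hq => by
      simp only [fderiv_of_eqOn_comp hV hW hg hgW hF hX hq, ContinuousLinearMap.comp_apply]
  have d1 : HasFDerivAt (fun q => fderiv ℝ F (g q))
      (fderiv ℝ (fderiv ℝ F) (g p) ∘L fderiv ℝ g p) p :=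
    ((hF.fderiv_smooth hW).differentiableAt_of_isOpen hW (hgW hp)).hasFDerivAt.comp p
      (hg.differentiableAt_of_isOpen hV hp).hasFDerivAt
  have d2 := d1.clm_apply (hg.hasFDerivAt_fderiv_apply hV hp b)
  have d3 := (hXs.hasFDerivAt_fderiv_apply hV hp b).unique (d2.congr_of_eventuallyEq e)
  have d4 := congrArg (fun L => ⟪L a, η⟫) d3
  simp only [ContinuousLinearMap.flip_apply, add_apply, ContinuousLinearMap.comp_apply,
    inner_add_left] at d4
  rw [d4, real_inner_comm, hη, zero_add]

/-- The image of L is a hyperplane, so its orthogonal complement is a line, spanned by ξ. -/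
theorem eq_smul_of_normal_isometric {L : EuclideanSpace ℝ (Fin 3) →L[ℝ] EuclideanSpace ℝ (Fin 4)}
    (hL : ∀ a b, ⟪L a, L b⟫ = ⟪a, b⟫) {ξ x : EuclideanSpace ℝ (Fin 4)} (hξ : ⟪ξ, ξ⟫ = 1)
    (hξL : ∀ w, ⟪ξ, L w⟫ = 0) (hx : ∀ w, ⟪x, L w⟫ = 0) : x = ⟪x, ξ⟫ • ξ := by
  have hr := finrank_range_of_inner_eq L hL
  set K := LinearMap.range (L : EuclideanSpace ℝ (Fin 3) →ₗ[ℝ] EuclideanSpace ℝ (Fin 4)) with hK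
  have h1 : Module.finrank ℝ Kᗮ = 1 := by
    have := K.finrank_add_finrank_orthogonal
    rw [hr, finrank_euclideanSpace_fin, finrank_euclideanSpace_fin] at this
    omega
  have mem : ∀ y, (∀ w, ⟪y, L w⟫ = 0) → y ∈ Kᗮ := by
    intro y hy
    rw [Submodule.mem_orthogonal']
    rintro _ ⟨w, rfl⟩
    exact hy w
  exact Submodule.eq_smul_of_unit h1 (mem ξ hξL) hξ (mem x hx)

theorem exists_unit_normal_isometric
    (L : EuclideanSpace ℝ (Fin 3) →L[ℝ] EuclideanSpace ℝ (Fin 4))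
    (hL : ∀ a b, ⟪L a, L b⟫ = ⟪a, b⟫) : ∃ ξ, ⟪ξ, ξ⟫ = 1 ∧ ∀ w, ⟪ξ, L w⟫ = 0 := by
  have hr := finrank_range_of_inner_eq L hL
  set K := LinearMap.range (L : EuclideanSpace ℝ (Fin 3) →ₗ[ℝ] EuclideanSpace ℝ (Fin 4)) with hK
  have h1 : 0 < Module.finrank ℝ Kᗮ := by
    have := K.finrank_add_finrank_orthogonal
    rw [hr, finrank_euclideanSpace_fin, finrank_euclideanSpace_fin] at this
    omega
  have : Nontrivial Kᗮ := Module.finrank_pos_iff.1 h1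
  obtain ⟨ξ, hξ⟩ := exists_norm_eq Kᗮ zero_le_one
  refine ⟨ξ, ?_, fun w => ?_⟩
  · rw [real_inner_self_eq_norm_sq, show ‖(ξ : EuclideanSpace ℝ (Fin 4))‖ = 1 from hξ, one_pow]
  · exact Submodule.inner_left_of_mem_orthogonal (LinearMap.mem_range_self _ w) ξ.2

/-- The unit normal of an isometric immersion `F` is parallel, along a composition `F ∘ g`, in every
direction in which the second fundamental form of `F` vanishes. -/
theorem inner_fderiv_normal_eq_zero (hV : IsOpen V) (hW : IsOpen W)
    (hg : ContDiffOn ℝ ∞ g V) (hgW : Set.MapsTo g V W) (hF : ContDiffOn ℝ ∞ F W)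
    (hiso : ∀ q ∈ W, ∀ a b, ⟪fderiv ℝ F q a, fderiv ℝ F q b⟫ = ⟪a, b⟫)
    (hX : Set.EqOn X (F ∘ g) V) (hXs : ContDiffOn ℝ ∞ X V) (hp : p ∈ V)
    {ξ : EuclideanSpace ℝ (Fin 2) → EuclideanSpace ℝ (Fin 4)} (hξ : DifferentiableAt ℝ ξ p)
    (hunit : ⟪ξ p, ξ p⟫ = 1) {O : Set (EuclideanSpace ℝ (Fin 2))} (hO : IsOpen O) (hpO : p ∈ O)
    (hn : ∀ q ∈ O, ∀ w, ⟪ξ q, fderiv ℝ F (g q) w⟫ = 0) {t : EuclideanSpace ℝ (Fin 2)}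
    (ht : ⟪fderiv ℝ (fderiv ℝ X) p t t, ξ p⟫ = 0) (w : EuclideanSpace ℝ (Fin 3)) :
    ⟪fderiv ℝ ξ p t, fderiv ℝ F (g p) w⟫ = 0 := by
  have hgp := hgW hp
  have hnormal : ∀ a b, fderiv ℝ (fderiv ℝ F) (g p) a b =
      ⟪fderiv ℝ (fderiv ℝ F) (g p) a b, ξ p⟫ • ξ p := fun a b =>
    eq_smul_of_normal_isometric (hiso _ hgp) hunit (hn p hpO)
      fun c => inner_fderiv_fderiv_of_isometric hF hW hiso hgp a b c
  rw [inner_fderiv_fderiv_of_eqOn_comp hV hW hg hgW hF hX hXs hp (hn p hpO)] at ht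
  -- The Gauss equation for the null vector dg(t) and w reads 0 = |D²F(dg(t), w)|²: null vectors lie
  -- in the kernel.
  have hzero : fderiv ℝ (fderiv ℝ F) (g p) (fderiv ℝ g p t) w = 0 := by
    have := gauss_equation_of_isometric hF hW hiso hgp (fderiv ℝ g p t) w
    rw [hnormal (fderiv ℝ g p t) (fderiv ℝ g p t), ht, zero_smul, inner_zero_left] at this
    exact inner_self_eq_zero.1 this.symm
  have d1 : HasFDerivAt (fun q => fderiv ℝ F (g q) w)
      (((fderiv ℝ (fderiv ℝ F) (g p)).flip w) ∘L fderiv ℝ g p) p :=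
    (hF.hasFDerivAt_fderiv_apply hW hgp w).comp p (hg.differentiableAt_of_isOpen hV hp).hasFDerivAt
  have := inner_fderiv_add_eq_zero_of_const hO hpO hξ d1.differentiableAt (fun q hq => hn q hq w) t
  rw [d1.fderiv] at this
  simp only [ContinuousLinearMap.comp_apply, ContinuousLinearMap.flip_apply] at this
  rwa [hzero, inner_zero_right, zero_add] at this

end Composition

/-! ### Failure of geodesics, and the normal of a flat hypersurface -/

section AdaptedFrame

variable {V : Set (EuclideanSpace ℝ (Fin 2))}
  {X : EuclideanSpace ℝ (Fin 2) → EuclideanSpace ℝ (Fin 4)}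
  {P : Submodule ℝ (EuclideanSpace ℝ (Fin 4))} {θ₁ θ₂ : ℝ}
  {e₁ e₂ n₁ n₂ : EuclideanSpace ℝ (Fin 2) → EuclideanSpace ℝ (Fin 4)}
  {p : EuclideanSpace ℝ (Fin 2)}

namespace IsAdaptedFrame

/-- The nonvanishing connection forms of an adapted frame with first normal spaces of
dimension two. -/
theorem exists_connection_ne_zero (h : IsAdaptedFrame V X P θ₁ θ₂ e₁ e₂ n₁ n₂) (hp : p ∈ V)
    (hs₁ : 0 < Real.sin θ₁) (hc₁ : 0 < Real.cos θ₁) (hs₂ : 0 < Real.sin θ₂) (hc₂ : 0 < Real.cos θ₂)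
    (hN : Module.finrank ℝ (firstNormalSpace X p) = 2) {t₁ t₂ : EuclideanSpace ℝ (Fin 2)}
    (ht₁ : fderiv ℝ X p t₁ = Real.cos θ₁ • e₁ p + Real.sin θ₁ • n₁ p)
    (ht₂ : fderiv ℝ X p t₂ = Real.cos θ₂ • e₂ p + Real.sin θ₂ • n₂ p) :
    ∃ A B : EuclideanSpace ℝ (Fin 2) → ℝ,
      (∀ a, fderiv ℝ e₁ p a = A a • e₂ p ∧ fderiv ℝ e₂ p a = -A a • e₁ p) ∧
      (∀ a, fderiv ℝ n₁ p a = B a • n₂ p ∧ fderiv ℝ n₂ p a = -B a • n₁ p) ∧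
      Real.cos θ₁ * Real.cos θ₂ * A t₁ + Real.sin θ₁ * Real.sin θ₂ * B t₁ ≠ 0 ∧
      Real.sin θ₁ * Real.sin θ₂ * A t₁ + Real.cos θ₁ * Real.cos θ₂ * B t₁ ≠ 0 ∧
      Real.cos θ₁ * Real.cos θ₂ * A t₂ + Real.sin θ₁ * Real.sin θ₂ * B t₂ ≠ 0 ∧
      Real.sin θ₁ * Real.sin θ₂ * A t₂ + Real.cos θ₁ * Real.cos θ₂ * B t₂ ≠ 0 := by
  obtain ⟨A, B, hA, hB⟩ := h.exists_connection hp
  obtain ⟨r1, r2⟩ := h.connection_relations hp hA hB ht₁ ht₂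
  obtain ⟨hl, hm⟩ := (h.finrank_firstNormalSpace_eq_two_iff hp hA hB ht₁ ht₂).1 hN
  obtain ⟨k1, k2⟩ := connection_ne_zero hs₁ hc₁ hs₂ hc₂ r1 hl
  -- Along t₂ the relation has the roles of A and B exchanged, so `k3` concerns the normal
  -- connection form and `k4` the Levi-Civita form.
  obtain ⟨k3, k4⟩ := connection_ne_zero hs₁ hc₁ hs₂ hc₂ r2.symm hm
  exact ⟨A, B, hA, hB, k1, k2, by rwa [add_comm], by rwa [add_comm]⟩

/-- The T₂-component of ∇T₁ along T₁ is the Levi-Civita form c₁c₂A + s₁s₂B at t₁. -/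
theorem covariantDerivative_tangent₁_ne_zero (h : IsAdaptedFrame V X P θ₁ θ₂ e₁ e₂ n₁ n₂)
    (hp : p ∈ V) (hs₁ : 0 < Real.sin θ₁) (hc₁ : 0 < Real.cos θ₁) (hs₂ : 0 < Real.sin θ₂)
    (hc₂ : 0 < Real.cos θ₂) (hN : Module.finrank ℝ (firstNormalSpace X p) = 2)
    {t : EuclideanSpace ℝ (Fin 2)}
    (ht : fderiv ℝ X p t = Real.cos θ₁ • e₁ p + Real.sin θ₁ • n₁ p) :
    covariantDerivative X (fun q => Real.cos θ₁ • e₁ q + Real.sin θ₁ • n₁ q) p t ≠ 0 := by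
  obtain ⟨-, t₂, -, ht₂⟩ := h.exists_coordinates hp
  obtain ⟨A, B, hA, hB, k, -⟩ := h.exists_connection_ne_zero hp hs₁ hc₁ hs₂ hc₂ hN ht ht₂
  obtain ⟨d1, d2, d3, d4⟩ := h.differentiableAt hp
  intro h0
  apply k
  have e := congrArg (fun x => ⟪x, Real.cos θ₂ • e₂ p + Real.sin θ₂ • n₂ p⟫) h0
  simp only [covariantDerivative, inner_zero_left] at e
  rw [Submodule.inner_starProjection_left_eq_right,
    Submodule.starProjection_eq_self_iff.2 (h.tangent₂ p hp),
    (hasFDerivAt_combination d1 d3 _ _).fderiv, add_apply, smul_apply, smul_apply, (hA t).1,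
    (hB t).1] at e
  have i := h.inner_combination hp 0 (Real.cos θ₁ * A t) 0 (Real.sin θ₁ * B t) 0 (Real.cos θ₂) 0
    (Real.sin θ₂)
  simp only [zero_smul, zero_add, add_zero] at i
  rw [smul_smul, smul_smul, i] at e
  linarith

theorem covariantDerivative_tangent₂_ne_zero (h : IsAdaptedFrame V X P θ₁ θ₂ e₁ e₂ n₁ n₂)
    (hp : p ∈ V) (hs₁ : 0 < Real.sin θ₁) (hc₁ : 0 < Real.cos θ₁) (hs₂ : 0 < Real.sin θ₂)
    (hc₂ : 0 < Real.cos θ₂) (hN : Module.finrank ℝ (firstNormalSpace X p) = 2)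
    {t : EuclideanSpace ℝ (Fin 2)}
    (ht : fderiv ℝ X p t = Real.cos θ₂ • e₂ p + Real.sin θ₂ • n₂ p) :
    covariantDerivative X (fun q => Real.cos θ₂ • e₂ q + Real.sin θ₂ • n₂ q) p t ≠ 0 := by
  obtain ⟨t₁, -, ht₁, -⟩ := h.exists_coordinates hp
  obtain ⟨A, B, hA, hB, -, -, k, -⟩ := h.exists_connection_ne_zero hp hs₁ hc₁ hs₂ hc₂ hN ht₁ ht
  obtain ⟨d1, d2, d3, d4⟩ := h.differentiableAt hp
  intro h0
  apply k
  have e := congrArg (fun x => ⟪x, Real.cos θ₁ • e₁ p + Real.sin θ₁ • n₁ p⟫) h0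
  simp only [covariantDerivative, inner_zero_left] at e
  rw [Submodule.inner_starProjection_left_eq_right,
    Submodule.starProjection_eq_self_iff.2 (h.tangent₁ p hp),
    (hasFDerivAt_combination d2 d4 _ _).fderiv, add_apply, smul_apply, smul_apply, (hA t).2,
    (hB t).2] at e
  have i := h.inner_combination hp (Real.cos θ₂ * -A t) 0 (Real.sin θ₂ * -B t) 0 (Real.cos θ₁) 0
    (Real.sin θ₁) 0
  simp only [zero_smul, add_zero] at i
  rw [smul_smul, smul_smul, i] at e
  linarith

/-- A unit normal of the ambient flat hypersurface is one of the two normals of the frame. -/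
theorem normal_of_composition (h : IsAdaptedFrame V X P θ₁ θ₂ e₁ e₂ n₁ n₂)
    {W : Set (EuclideanSpace ℝ (Fin 3))} {g : EuclideanSpace ℝ (Fin 2) → EuclideanSpace ℝ (Fin 3)}
    {F : EuclideanSpace ℝ (Fin 3) → EuclideanSpace ℝ (Fin 4)} (hW : IsOpen W)
    (hg : ContDiffOn ℝ ∞ g V) (hgW : Set.MapsTo g V W) (hF : ContDiffOn ℝ ∞ F W)
    (hiso : ∀ q ∈ W, ∀ a b, ⟪fderiv ℝ F q a, fderiv ℝ F q b⟫ = ⟪a, b⟫)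
    (hX : Set.EqOn X (F ∘ g) V) (hp : p ∈ V)
    (hN : Module.finrank ℝ (firstNormalSpace X p) = 2) :
    (∀ w, ⟪-Real.sin θ₁ • e₁ p + Real.cos θ₁ • n₁ p, fderiv ℝ F (g p) w⟫ = 0) ∨
      ∀ w, ⟪-Real.sin θ₂ • e₂ p + Real.cos θ₂ • n₂ p, fderiv ℝ F (g p) w⟫ = 0 := by
  have hgp := hgW hp
  obtain ⟨η, hη, hηF⟩ := exists_unit_normal_isometric _ (hiso _ hgp)
  obtain ⟨t₁, t₂, ht₁, ht₂⟩ := h.exists_coordinates hp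
  obtain ⟨A, B, hA, hB⟩ := h.exists_connection hp
  obtain ⟨hl, hm⟩ := (h.finrank_firstNormalSpace_eq_two_iff hp hA hB ht₁ ht₂).1 hN
  have eq := h.inner_second_derivative_eq hp hA hB ht₁ ht₂
  obtain ⟨i1, i2, i3⟩ := h.inner_tangent hp
  have i4 := i3
  rw [real_inner_comm] at i4
  have hηX : η ∈ (tangentPlane X p)ᗮ := by
    rw [Submodule.mem_orthogonal']
    rintro _ ⟨a, rfl⟩
    rw [ContinuousLinearMap.coe_coe, fderiv_of_eqOn_comp h.isOpen hW hg hgW hF hX hp]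
    exact hηF _
  have hηe := h.normal_eq hp η hηX
  set x := ⟪η, -Real.sin θ₁ • e₁ p + Real.cos θ₁ • n₁ p⟫
  set y := ⟪η, -Real.sin θ₂ • e₂ p + Real.cos θ₂ • n₂ p⟫
  have hnormal : ∀ a b, fderiv ℝ (fderiv ℝ F) (g p) a b =
      ⟪fderiv ℝ (fderiv ℝ F) (g p) a b, η⟫ • η := fun a b =>
    eq_smul_of_normal_isometric (hiso _ hgp) hη hηF
      fun c => inner_fderiv_fderiv_of_isometric hF hW hiso hgp a b c
  have gauss := gauss_equation_of_isometric hF hW hiso hgp (fderiv ℝ g p t₁) (fderiv ℝ g p t₂)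
  rw [hnormal (fderiv ℝ g p t₁) (fderiv ℝ g p t₁), hnormal (fderiv ℝ g p t₂) (fderiv ℝ g p t₂),
    hnormal (fderiv ℝ g p t₁) (fderiv ℝ g p t₂)] at gauss
  simp only [real_inner_smul_left, real_inner_smul_right, hη] at gauss
  simp only [← inner_fderiv_fderiv_of_eqOn_comp h.isOpen hW hg hgW hF hX h.smooth hp hηF] at gauss
  have hval : ∀ a b, ⟪fderiv ℝ (fderiv ℝ X) p a b, η⟫ =
      x * ⟪fderiv ℝ (fderiv ℝ X) p a b, -Real.sin θ₁ • e₁ p + Real.cos θ₁ • n₁ p⟫ +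
      y * ⟪fderiv ℝ (fderiv ℝ X) p a b, -Real.sin θ₂ • e₂ p + Real.cos θ₂ • n₂ p⟫ := by
    intro a b
    conv_lhs => rw [hηe]
    rw [inner_add_right, real_inner_smul_right, real_inner_smul_right]
  simp only [hval, (eq _ _).1, (eq _ _).2, ht₁, ht₂, i1, i2, i3, i4] at gauss
  -- On the pair t₁, t₂ the form of F is diagonal with entries y·l and x·m, so the Gauss equation
  -- says that their product vanishes.
  have hxy : x * y = 0 := by
    have : (x * y) * ((Real.sin θ₁ * Real.cos θ₂ * B t₁ - Real.cos θ₁ * Real.sin θ₂ * A t₁) *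
      (Real.sin θ₁ * Real.cos θ₂ * A t₂ - Real.cos θ₁ * Real.sin θ₂ * B t₂)) = 0 := by
      linear_combination gauss
    exact (mul_eq_zero.1 this).resolve_right (mul_ne_zero hl hm)
  rcases mul_eq_zero.1 hxy with hx | hy
  · right
    intro w
    have hw := hηF w
    rw [hηe, hx, zero_smul, zero_add, real_inner_smul_left] at hw
    refine (mul_eq_zero.1 hw).resolve_left fun hy => ?_
    rw [hηe, hx, hy, zero_smul, zero_smul, add_zero, inner_zero_left] at hη
    exact zero_ne_one hη
  · left
    intro w
    have hw := hηF w
    rw [hηe, hy, zero_smul, add_zero, real_inner_smul_left] at hw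
    refine (mul_eq_zero.1 hw).resolve_left fun hx => ?_
    rw [hηe, hx, hy, zero_smul, zero_smul, add_zero, inner_zero_left] at hη
    exact zero_ne_one hη

end IsAdaptedFrame

end AdaptedFrame

/-! ### Non-compositions, and frames from principal fields -/

section Composition

theorem inner_eq_zero_of_normal_isometric
    {L : EuclideanSpace ℝ (Fin 3) →L[ℝ] EuclideanSpace ℝ (Fin 4)}
    (hL : ∀ a b, ⟪L a, L b⟫ = ⟪a, b⟫) {ξ ξ' y : EuclideanSpace ℝ (Fin 4)} (hξ : ⟪ξ, ξ⟫ = 1)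
    (hξL : ∀ w, ⟪ξ, L w⟫ = 0) (horth : ⟪ξ, ξ'⟫ = 0) (hy : ∀ w, ⟪y, L w⟫ = 0) : ⟪y, ξ'⟫ = 0 := by
  rw [eq_smul_of_normal_isometric hL hξ hξL hy, real_inner_smul_left, horth, mul_zero]

/-- If at every point one of two orthonormal fields is normal to `F`, then near a point where `ξ`
is normal its derivative in a direction that is null for `F` has no component along `ξ'`. -/
theorem inner_fderiv_eq_zero_of_alternative {V : Set (EuclideanSpace ℝ (Fin 2))}
    {X : EuclideanSpace ℝ (Fin 2) → EuclideanSpace ℝ (Fin 4)}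
    {W : Set (EuclideanSpace ℝ (Fin 3))}
    {g : EuclideanSpace ℝ (Fin 2) → EuclideanSpace ℝ (Fin 3)}
    {F : EuclideanSpace ℝ (Fin 3) → EuclideanSpace ℝ (Fin 4)} {p : EuclideanSpace ℝ (Fin 2)}
    (hV : IsOpen V) (hW : IsOpen W)
    (hg : ContDiffOn ℝ ∞ g V) (hgW : Set.MapsTo g V W) (hF : ContDiffOn ℝ ∞ F W)
    (hiso : ∀ q ∈ W, ∀ a b, ⟪fderiv ℝ F q a, fderiv ℝ F q b⟫ = ⟪a, b⟫)
    (hX : Set.EqOn X (F ∘ g) V) (hXs : ContDiffOn ℝ ∞ X V) (hp : p ∈ V)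
    {ξ ξ' : EuclideanSpace ℝ (Fin 2) → EuclideanSpace ℝ (Fin 4)} (hξ : DifferentiableAt ℝ ξ p)
    (hξ' : ContinuousOn ξ' V) (hunit : ⟪ξ p, ξ p⟫ = 1) (hunit' : ⟪ξ' p, ξ' p⟫ = 1)
    (horth : ⟪ξ p, ξ' p⟫ = 0) (hn : ∀ w, ⟪ξ p, fderiv ℝ F (g p) w⟫ = 0)
    (halt : ∀ q ∈ V, (∀ w, ⟪ξ' q, fderiv ℝ F (g q) w⟫ = 0) ∨ ∀ w, ⟪ξ q, fderiv ℝ F (g q) w⟫ = 0)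
    {t : EuclideanSpace ℝ (Fin 2)} (ht : ⟪fderiv ℝ (fderiv ℝ X) p t t, ξ p⟫ = 0) :
    ⟪fderiv ℝ ξ p t, ξ' p⟫ = 0 := by
  have hL := hiso _ (hgW hp)
  -- The normals of F at one point form a line, so ξ' is not normal at p. This is an open condition,
  -- detected by a single w; on the open set where it persists the alternative forces ξ to be
  -- normal, which allows differentiation.
  obtain ⟨w, hw⟩ : ∃ w, ⟪ξ' p, fderiv ℝ F (g p) w⟫ ≠ 0 := by
    by_contra! hall
    have := inner_eq_zero_of_normal_isometric hL hunit hn horth hall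
    rw [hunit'] at this
    exact one_ne_zero this
  have hcont : ContinuousOn (fun q => ⟪ξ' q, fderiv ℝ F (g q) w⟫) V :=
    hξ'.inner (((hF.fderiv_smooth hW).continuousOn.comp hg.continuousOn hgW).clm_apply
      continuousOn_const)
  have hO : IsOpen (V ∩ (fun q => ⟪ξ' q, fderiv ℝ F (g q) w⟫) ⁻¹' {0}ᶜ) :=
    hcont.isOpen_inter_preimage hV isOpen_compl_singleton
  refine inner_eq_zero_of_normal_isometric hL hunit hn horth
    (inner_fderiv_normal_eq_zero hV hW hg hgW hF hiso hX hXs hp hξ hunit hO ⟨hp, hw⟩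
      (fun q hq => ?_) ht)
  exact (halt q hq.1).resolve_left fun h0 => hq.2 (h0 w)

end Composition

section AdaptedFrame

variable {V : Set (EuclideanSpace ℝ (Fin 2))}
  {X : EuclideanSpace ℝ (Fin 2) → EuclideanSpace ℝ (Fin 4)}
  {P : Submodule ℝ (EuclideanSpace ℝ (Fin 4))} {θ₁ θ₂ : ℝ}
  {e₁ e₂ n₁ n₂ : EuclideanSpace ℝ (Fin 2) → EuclideanSpace ℝ (Fin 4)}
  {p : EuclideanSpace ℝ (Fin 2)}

/-- If ξ₁ is normal to F at p, the direction T₁ is null for its form, so dξ₁(T₁) should have no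
ξ₂-component; that component is s₁s₂A + c₁c₂B at t₁, which is nonzero. The case of ξ₂ uses T₂. -/
theorem IsAdaptedFrame.not_isComposition (h : IsAdaptedFrame V X P θ₁ θ₂ e₁ e₂ n₁ n₂)
    (hp : p ∈ V) (hs₁ : 0 < Real.sin θ₁) (hc₁ : 0 < Real.cos θ₁) (hs₂ : 0 < Real.sin θ₂)
    (hc₂ : 0 < Real.cos θ₂)
    (hN : ∀ q ∈ V, Module.finrank ℝ (firstNormalSpace X q) = 2) : ¬ IsComposition V X := by
  rintro ⟨W, g, F, hW, hg, hgW, -, hF, hiso, hX⟩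
  have halt := fun q hq => h.normal_of_composition (p := q) hW hg hgW hF hiso hX hq (hN q hq)
  obtain ⟨t₁, t₂, ht₁, ht₂⟩ := h.exists_coordinates hp
  obtain ⟨A, B, hA, hB, -, k₁, -, k₂⟩ :=
    h.exists_connection_ne_zero hp hs₁ hc₁ hs₂ hc₂ (hN p hp) ht₁ ht₂
  have eq := h.inner_second_derivative_eq hp hA hB ht₁ ht₂
  obtain ⟨d1, d2, d3, d4⟩ := h.differentiableAt hp
  obtain ⟨u1, u2, o⟩ := h.inner_normal hp
  obtain ⟨-, -, o'⟩ := h.inner_tangent hp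
  have c1 : ContinuousOn (fun q => -Real.sin θ₁ • e₁ q + Real.cos θ₁ • n₁ q) V := by
    have := h.base.smooth₁.continuousOn
    have := h.fibre.smooth₁.continuousOn
    fun_prop
  have c2 : ContinuousOn (fun q => -Real.sin θ₂ • e₂ q + Real.cos θ₂ • n₂ q) V := by
    have := h.base.smooth₂.continuousOn
    have := h.fibre.smooth₂.continuousOn
    fun_prop
  rcases halt p hp with hn | hn
  · have := inner_fderiv_eq_zero_of_alternative h.isOpen hW hg hgW hF hiso hX h.smooth hp
      (ξ := fun q => -Real.sin θ₁ • e₁ q + Real.cos θ₁ • n₁ q)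
      (ξ' := fun q => -Real.sin θ₂ • e₂ q + Real.cos θ₂ • n₂ q)
      (hasFDerivAt_combination d1 d3 _ _).differentiableAt
      c2 u1 u2 o hn (fun q hq => (halt q hq).symm) (t := t₁)
      (by rw [(eq t₁ t₁).1, ht₁, o']; ring)
    rw [(hasFDerivAt_combination d1 d3 _ _).fderiv, add_apply, smul_apply, smul_apply, (hA t₁).1,
      (hB t₁).1, smul_smul, smul_smul] at this
    have i := h.inner_combination hp 0 (-Real.sin θ₁ * A t₁) 0 (Real.cos θ₁ * B t₁) 0
      (-Real.sin θ₂) 0 (Real.cos θ₂)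
    simp only [zero_smul, zero_add, add_zero] at i
    rw [i] at this
    exact k₁ (by linarith)
  · have := inner_fderiv_eq_zero_of_alternative h.isOpen hW hg hgW hF hiso hX h.smooth hp
      (ξ := fun q => -Real.sin θ₂ • e₂ q + Real.cos θ₂ • n₂ q)
      (ξ' := fun q => -Real.sin θ₁ • e₁ q + Real.cos θ₁ • n₁ q)
      (hasFDerivAt_combination d2 d4 _ _).differentiableAt
      c1 u2 u1 (by rw [real_inner_comm]; exact o) hn halt (t := t₂)
      (by rw [(eq t₂ t₂).2, ht₂, real_inner_comm, o']; ring)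
    rw [(hasFDerivAt_combination d2 d4 _ _).fderiv, add_apply, smul_apply, smul_apply, (hA t₂).2,
      (hB t₂).2, smul_smul, smul_smul] at this
    have i := h.inner_combination hp (-Real.sin θ₂ * -A t₂) 0 (Real.cos θ₂ * -B t₂) 0
      (-Real.sin θ₁) 0 (Real.cos θ₁) 0
    simp only [zero_smul, add_zero] at i
    rw [i] at this
    exact k₂ (by linarith)

/-- Smooth principal fields for two different angles give an adapted frame. -/
theorem IsPrincipalField.isAdaptedFrame (hV : IsOpen V) (hX : ContDiffOn ℝ ∞ X V)
    (himm : ∀ p ∈ V, Function.Injective (fderiv ℝ X p)) (hP : Module.finrank ℝ P = 2)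
    {T₁ T₂ : EuclideanSpace ℝ (Fin 2) → EuclideanSpace ℝ (Fin 4)}
    (h₁ : IsPrincipalField V X P θ₁ T₁) (h₂ : IsPrincipalField V X P θ₂ T₂)
    (hs₁ : Real.sin θ₁ ≠ 0) (hc₁ : Real.cos θ₁ ≠ 0) (hs₂ : Real.sin θ₂ ≠ 0)
    (hc₂ : Real.cos θ₂ ≠ 0) (hne : Real.cos θ₁ ^ 2 ≠ Real.cos θ₂ ^ 2) :
    ∃ e₁ e₂ n₁ n₂, IsAdaptedFrame V X P θ₁ θ₂ e₁ e₂ n₁ n₂ ∧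
      (∀ q, Real.cos θ₁ • e₁ q + Real.sin θ₁ • n₁ q = T₁ q) ∧
      ∀ q, Real.cos θ₂ • e₂ q + Real.sin θ₂ • n₂ q = T₂ q := by
  have hsum₁ : ∀ q, Real.cos θ₁ • (Real.cos θ₁)⁻¹ • P.starProjection (T₁ q) +
      Real.sin θ₁ • (Real.sin θ₁)⁻¹ • Pᗮ.starProjection (T₁ q) = T₁ q := fun q => by
    rw [smul_inv_smul₀ hc₁, smul_inv_smul₀ hs₁]
    exact P.starProjection_add_starProjection_orthogonal _
  have hsum₂ : ∀ q, Real.cos θ₂ • (Real.cos θ₂)⁻¹ • P.starProjection (T₂ q) +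
      Real.sin θ₂ • (Real.sin θ₂)⁻¹ • Pᗮ.starProjection (T₂ q) = T₂ q := fun q => by
    rw [smul_inv_smul₀ hc₂, smul_inv_smul₀ hs₂]
    exact P.starProjection_add_starProjection_orthogonal _
  have smooth : ∀ {K : Submodule ℝ (EuclideanSpace ℝ (Fin 4))} (c : ℝ)
      {T : EuclideanSpace ℝ (Fin 2) → EuclideanSpace ℝ (Fin 4)}, ContDiffOn ℝ ∞ T V →
      ContDiffOn ℝ ∞ (fun q => c • K.starProjection (T q)) V := fun {K} c _ hT =>
    (K.starProjection.contDiff.comp_contDiffOn hT).const_smul c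
  have base : ∀ {θ θ' : ℝ} {T T' : EuclideanSpace ℝ (Fin 2) → EuclideanSpace ℝ (Fin 4)},
      IsPrincipalField V X P θ T → IsPrincipalField V X P θ' T' → ∀ q ∈ V,
      ⟪P.starProjection (T q), P.starProjection (T' q)⟫ = Real.cos θ ^ 2 * ⟪T q, T' q⟫ := by
    intro θ θ' T T' h h' q hq
    obtain ⟨-, hm, hv⟩ := h.2 q hq
    obtain ⟨-, hm', -⟩ := h'.2 q hq
    rw [← inner_angleOperator P (tangentPlane X q) ⟨T q, hm⟩ ⟨T' q, hm'⟩, hv.apply_eq_smul,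
      real_inner_smul_left]
    rfl
  have fibre : ∀ {θ θ' : ℝ} {T T' : EuclideanSpace ℝ (Fin 2) → EuclideanSpace ℝ (Fin 4)},
      IsPrincipalField V X P θ T → IsPrincipalField V X P θ' T' → ∀ q ∈ V,
      ⟪Pᗮ.starProjection (T q), Pᗮ.starProjection (T' q)⟫ = Real.sin θ ^ 2 * ⟪T q, T' q⟫ := by
    intro θ θ' T T' h h' q hq
    have hb := base h h' q hq
    have e : ⟪T q, T' q⟫ = ⟪P.starProjection (T q), P.starProjection (T' q)⟫ +
        ⟪Pᗮ.starProjection (T q), Pᗮ.starProjection (T' q)⟫ := by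
      conv_lhs => rw [← P.starProjection_add_starProjection_orthogonal (T q),
        ← P.starProjection_add_starProjection_orthogonal (T' q)]
      rw [inner_add_left, inner_add_right, inner_add_right,
        Submodule.inner_right_of_mem_orthogonal (P.starProjection_apply_mem (T q))
          (Pᗮ.starProjection_apply_mem (T' q)),
        Submodule.inner_left_of_mem_orthogonal (P.starProjection_apply_mem (T' q))
          (Pᗮ.starProjection_apply_mem (T q))]
      ring
    rw [hb] at e
    linear_combination -e - ⟪T q, T' q⟫ * Real.sin_sq_add_cos_sq θ
  have unit : ∀ {θ : ℝ} {T : EuclideanSpace ℝ (Fin 2) → EuclideanSpace ℝ (Fin 4)},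
      IsPrincipalField V X P θ T → ∀ q ∈ V, ⟪T q, T q⟫ = 1 := fun h q hq => by
    rw [real_inner_self_eq_norm_sq, (h.2 q hq).1, one_pow]
  have orth : ∀ q ∈ V, ⟪T₁ q, T₂ q⟫ = 0 := fun q hq => by
    obtain ⟨-, hm, hv⟩ := h₁.2 q hq
    obtain ⟨-, hm', hv'⟩ := h₂.2 q hq
    exact inner_eq_zero_of_hasEigenvector hne hv hv'
  -- The projections of Tᵢ to `P` and `Pᗮ` have lengths cos θᵢ and sin θᵢ; dividing by them gives
  -- the frame. Orthogonality holds because eigenvectors for distinct eigenvalues are orthogonal,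
  -- also after either projection.
  refine ⟨fun q => (Real.cos θ₁)⁻¹ • P.starProjection (T₁ q),
    fun q => (Real.cos θ₂)⁻¹ • P.starProjection (T₂ q),
    fun q => (Real.sin θ₁)⁻¹ • Pᗮ.starProjection (T₁ q),
    fun q => (Real.sin θ₂)⁻¹ • Pᗮ.starProjection (T₂ q),
    ⟨hV, hX, himm, hP, ⟨smooth _ h₁.1, smooth _ h₂.1,
      fun q _ => P.smul_mem _ (P.starProjection_apply_mem _),
      fun q _ => P.smul_mem _ (P.starProjection_apply_mem _), ?_, ?_, ?_⟩,
      ⟨smooth _ h₁.1, smooth _ h₂.1,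
      fun q _ => Pᗮ.smul_mem _ (Pᗮ.starProjection_apply_mem _),
      fun q _ => Pᗮ.smul_mem _ (Pᗮ.starProjection_apply_mem _), ?_, ?_, ?_⟩, ?_, ?_⟩,
    hsum₁, hsum₂⟩
  · intro q hq
    rw [real_inner_smul_left, real_inner_smul_right, base h₁ h₁ q hq, unit h₁ q hq]
    field_simp
  · intro q hq
    rw [real_inner_smul_left, real_inner_smul_right, base h₂ h₂ q hq, unit h₂ q hq]
    field_simp
  · intro q hq
    rw [real_inner_smul_left, real_inner_smul_right, base h₁ h₂ q hq, orth q hq]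
    ring
  · intro q hq
    rw [real_inner_smul_left, real_inner_smul_right, fibre h₁ h₁ q hq, unit h₁ q hq]
    field_simp
  · intro q hq
    rw [real_inner_smul_left, real_inner_smul_right, fibre h₂ h₂ q hq, unit h₂ q hq]
    field_simp
  · intro q hq
    rw [real_inner_smul_left, real_inner_smul_right, fibre h₁ h₂ q hq, orth q hq]
    ring
  · intro q hq
    rw [hsum₁]
    exact (h₁.2 q hq).2.1
  · intro q hq
    rw [hsum₂]
    exact (h₂.2 q hq).2.1

end AdaptedFrame

/-! ### Local existence of smooth principal fields -/

section PrincipalFields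

variable {U : Set (EuclideanSpace ℝ (Fin 2))}
  {X : EuclideanSpace ℝ (Fin 2) → EuclideanSpace ℝ (Fin 4)}
  {P : Submodule ℝ (EuclideanSpace ℝ (Fin 4))} {θ₁ θ₂ : ℝ}

/-- The orthogonal projection onto the tangent planes of a surface preserves smoothness. -/
theorem contDiffOn_starProjection_tangentPlane (hU : IsOpen U) (hX : ContDiffOn ℝ ∞ X U)
    (himm : ∀ p ∈ U, Function.Injective (fderiv ℝ X p))
    {z : EuclideanSpace ℝ (Fin 2) → EuclideanSpace ℝ (Fin 4)} (hz : ContDiffOn ℝ ∞ z U) :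
    ContDiffOn ℝ ∞ (fun q => (tangentPlane X q).starProjection (z q)) U := by
  -- Gram–Schmidt on the coordinate fields dX(b 0), dX(b 1) gives a smooth orthonormal frame u, v in
  -- which the projection is explicit.
  let b : Fin 2 → EuclideanSpace ℝ (Fin 2) := fun i => EuclideanSpace.single i 1
  let x := fun q => fderiv ℝ X q (b 0)
  let u := fun q => ‖x q‖⁻¹ • x q
  let y := fun q => fderiv ℝ X q (b 1) - ⟪fderiv ℝ X q (b 1), u q⟫ • u q
  let v := fun q => ‖y q‖⁻¹ • y q
  have hD := hX.fderiv_smooth hU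
  have hx0 : ∀ q ∈ U, x q ≠ 0 := by
    intro q hq h0
    have h1 : b 0 = 0 := himm q hq (by rw [map_zero]; exact h0)
    have := congrArg (fun w : EuclideanSpace ℝ (Fin 2) => w 0) h1
    simp [b] at this
  have hy0 : ∀ q ∈ U, y q ≠ 0 := by
    intro q hq h0
    have h1 : b 1 - (⟪fderiv ℝ X q (b 1), u q⟫ * ‖x q‖⁻¹) • b 0 = 0 :=
      himm q hq (by rw [map_zero, map_sub, map_smul, mul_smul]; exact h0)
    have := congrArg (fun w : EuclideanSpace ℝ (Fin 2) => w 1) h1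
    simp [b] at this
  have hx : ContDiffOn ℝ ∞ x U := hD.clm_apply contDiffOn_const
  have hu : ContDiffOn ℝ ∞ u U :=
    ((hx.norm ℝ hx0).inv fun q hq => norm_ne_zero_iff.2 (hx0 q hq)).smul hx
  have hd1 : ContDiffOn ℝ ∞ (fun q => fderiv ℝ X q (b 1)) U := hD.clm_apply contDiffOn_const
  have hy : ContDiffOn ℝ ∞ y U := hd1.sub ((hd1.inner ℝ hu).smul hu)
  have hv : ContDiffOn ℝ ∞ v U :=
    ((hy.norm ℝ hy0).inv fun q hq => norm_ne_zero_iff.2 (hy0 q hq)).smul hy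
  have hunit : ∀ w : EuclideanSpace ℝ (Fin 4), w ≠ 0 → ⟪‖w‖⁻¹ • w, ‖w‖⁻¹ • w⟫ = 1 := by
    intro w hw
    have := norm_ne_zero_iff.2 hw
    rw [real_inner_smul_left, real_inner_smul_right, real_inner_self_eq_norm_sq]
    field_simp
  refine (((hz.inner ℝ hu).smul hu).add ((hz.inner ℝ hv).smul hv)).congr fun q hq => ?_
  have hmem : ∀ a, fderiv ℝ X q a ∈ tangentPlane X q := fun a => LinearMap.mem_range_self _ a
  have hum : u q ∈ tangentPlane X q := Submodule.smul_mem _ _ (hmem _)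
  have hym : y q ∈ tangentPlane X q := Submodule.sub_mem _ (hmem _) (Submodule.smul_mem _ _ hum)
  refine Submodule.starProjection_eq_of_orthonormal_pair (finrank_tangentPlane (himm q hq)) hum
    (Submodule.smul_mem _ _ hym) (hunit _ (hx0 q hq)) (hunit _ (hy0 q hq)) ?_ (z q)
  have : ⟪u q, y q⟫ = 0 := by
    rw [inner_sub_right, real_inner_smul_right, hunit _ (hx0 q hq), real_inner_comm, mul_one,
      sub_self]
  rw [real_inner_smul_right, this, mul_zero]

/-- A smooth eigenfield through a point for a simple eigenvalue. -/
theorem exists_isPrincipalField_of_eigenpairs (hU : IsOpen U) (hX : ContDiffOn ℝ ∞ X U)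
    (himm : ∀ p ∈ U, Function.Injective (fderiv ℝ X p)) {θ θ' : ℝ}
    (hne : Real.cos θ ^ 2 ≠ Real.cos θ' ^ 2)
    (hpair : ∀ q ∈ U, ∃ v ∈ tangentPlane X q, ∃ v' ∈ tangentPlane X q,
      ⟪v, v⟫ = 1 ∧ ⟪v', v'⟫ = 1 ∧ ⟪v, v'⟫ = 0 ∧
      (tangentPlane X q).starProjection (P.starProjection v) = Real.cos θ ^ 2 • v ∧
      (tangentPlane X q).starProjection (P.starProjection v') = Real.cos θ' ^ 2 • v')
    {p : EuclideanSpace ℝ (Fin 2)} (hp : p ∈ U) :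
    ∃ V ⊆ U, IsOpen V ∧ p ∈ V ∧ ∃ T, IsPrincipalField V X P θ T := by
  obtain ⟨v₀, hv₀, v₀', hv₀', n₀, n₀', o₀, e₀, e₀'⟩ := hpair p hp
  -- Applying S - cos² θ' to the tangential part of a fixed vector kills the θ'-component, leaving a
  -- smooth field of θ-eigenvectors. Starting from the eigenvector `v₀` at p makes it nonzero there,
  -- hence nearby.
  let z := fun q => (tangentPlane X q).starProjection v₀
  let w := fun q => (tangentPlane X q).starProjection (P.starProjection (z q)) -
    Real.cos θ' ^ 2 • z q
  have hz : ContDiffOn ℝ ∞ z U := contDiffOn_starProjection_tangentPlane hU hX himm contDiffOn_const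
  have hw : ContDiffOn ℝ ∞ w U :=
    (contDiffOn_starProjection_tangentPlane hU hX himm
      (P.starProjection.contDiff.comp_contDiffOn hz)).sub (hz.const_smul _)
  have key : ∀ q ∈ U, w q ∈ tangentPlane X q ∧
      (tangentPlane X q).starProjection (P.starProjection (w q)) = Real.cos θ ^ 2 • w q := by
    intro q hq
    obtain ⟨v, hv, v', hv', n, n', o, e, e'⟩ := hpair q hq
    have hzq : z q = ⟪v₀, v⟫ • v + ⟪v₀, v'⟫ • v' :=
      Submodule.starProjection_eq_of_orthonormal_pair (finrank_tangentPlane (himm q hq)) hv hv' n n'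
        o v₀
    have hwq : w q = ((Real.cos θ ^ 2 - Real.cos θ' ^ 2) * ⟪v₀, v⟫) • v := by
      simp only [w]
      rw [hzq, map_add, map_add, map_smul, map_smul, map_smul, map_smul, e, e']
      module
    rw [hwq]
    refine ⟨Submodule.smul_mem _ _ hv, ?_⟩
    rw [map_smul, map_smul, e, smul_comm]
  have hwp : w p ≠ 0 := by
    have hzp : z p = v₀ := Submodule.starProjection_eq_self_iff.2 hv₀
    have : w p = (Real.cos θ ^ 2 - Real.cos θ' ^ 2) • v₀ := by
      simp only [w]
      rw [hzp, e₀, sub_smul]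
    rw [this]
    refine smul_ne_zero (sub_ne_zero.2 hne) ?_
    rintro rfl
    simp at n₀
  have hVU : U ∩ w ⁻¹' {0}ᶜ ⊆ U := Set.inter_subset_left
  refine ⟨U ∩ w ⁻¹' {0}ᶜ, hVU,
    hw.continuousOn.isOpen_inter_preimage hU isOpen_compl_singleton, ⟨hp, hwp⟩,
    fun q => ‖w q‖⁻¹ • w q, ?_, fun q hq => ?_⟩
  · have hw' := hw.mono hVU
    exact ((hw'.norm ℝ fun q hq => hq.2).inv fun q hq => norm_ne_zero_iff.2 hq.2).smul hw'
  · have h0 : w q ≠ 0 := hq.2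
    obtain ⟨hm, he⟩ := key q hq.1
    refine ⟨norm_smul_inv_norm h0, Submodule.smul_mem _ _ hm, ?_⟩
    rw [hasEigenvector_angleOperator_iff, map_smul, map_smul, he, smul_comm]
    exact ⟨rfl, smul_ne_zero (inv_ne_zero (norm_ne_zero_iff.2 h0)) h0⟩

theorem IsPrincipalField.mono {V V' : Set (EuclideanSpace ℝ (Fin 2))} {θ : ℝ}
    {T : EuclideanSpace ℝ (Fin 2) → EuclideanSpace ℝ (Fin 4)} (h : IsPrincipalField V X P θ T)
    (hV : V' ⊆ V) : IsPrincipalField V' X P θ T :=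
  ⟨h.1.mono hV, fun p hp => h.2 p (hV hp)⟩

theorem HasConstantPrincipalAngles.exists_isPrincipalField
    (h : HasConstantPrincipalAngles U X P θ₁ θ₂) (hU : IsOpen U) (hX : ContDiffOn ℝ ∞ X U)
    (himm : ∀ p ∈ U, Function.Injective (fderiv ℝ X p))
    (hne : Real.cos θ₁ ^ 2 ≠ Real.cos θ₂ ^ 2) {p : EuclideanSpace ℝ (Fin 2)} (hp : p ∈ U) :
    ∃ V ⊆ U, IsOpen V ∧ p ∈ V ∧
      (∃ T₁, IsPrincipalField V X P θ₁ T₁) ∧ ∃ T₂, IsPrincipalField V X P θ₂ T₂ := by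
  have hpair : ∀ q ∈ U, ∃ v ∈ tangentPlane X q, ∃ v' ∈ tangentPlane X q,
      ⟪v, v⟫ = 1 ∧ ⟪v', v'⟫ = 1 ∧ ⟪v, v'⟫ = 0 ∧
      (tangentPlane X q).starProjection (P.starProjection v) = Real.cos θ₁ ^ 2 • v ∧
      (tangentPlane X q).starProjection (P.starProjection v') = Real.cos θ₂ ^ 2 • v' := by
    intro q hq
    obtain ⟨v, hv, v', hv', w, hw, w', hw', n, n', o, m, m', o', h11, h22, h12, h21⟩ :=
      (h.2 q hq).exists_pairs
    have hT := finrank_tangentPlane (himm q hq)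
    -- Projecting v to `P` gives cos θ₁ • w, and projecting w back gives cos θ₁ • v; hence the
    -- eigenvalue cos² θ₁. The second pair behaves alike.
    refine ⟨v, hv, v', hv', n, n', o, ?_, ?_⟩
    · rw [Submodule.starProjection_eq_of_orthonormal_pair h.1 hw hw' m m' o', h11, h12, zero_smul,
        add_zero, map_smul, Submodule.starProjection_eq_of_orthonormal_pair hT hv hv' n n' o,
        real_inner_comm, h11, real_inner_comm, h21, zero_smul, add_zero, smul_smul, pow_two]
    · rw [Submodule.starProjection_eq_of_orthonormal_pair h.1 hw hw' m m' o', h21, h22, zero_smul,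
        zero_add, map_smul, Submodule.starProjection_eq_of_orthonormal_pair hT hv hv' n n' o,
        real_inner_comm, h12, real_inner_comm, h22, zero_smul, zero_add, smul_smul, pow_two]
  obtain ⟨V, hVU, hV, hpV, T, hT⟩ := exists_isPrincipalField_of_eigenpairs hU hX himm hne hpair hp
  obtain ⟨V', hVU', hV', hpV', T', hT'⟩ := exists_isPrincipalField_of_eigenpairs hU hX himm hne.symm
    (fun q hq => by
      obtain ⟨v, hv, v', hv', n, n', o, e, e'⟩ := hpair q hq
      exact ⟨v', hv', v, hv, n', n, by rw [real_inner_comm]; exact o, e', e⟩) hp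
  exact ⟨V ∩ V', Set.inter_subset_left.trans hVU, hV.inter hV', ⟨hpV, hpV'⟩,
    ⟨T, hT.mono Set.inter_subset_left⟩, T', hT'.mono Set.inter_subset_right⟩

end PrincipalFields

/-! ### Local embeddings, and principal angles of an adapted frame -/

section Embedding

variable {E F : Type*} [NormedAddCommGroup E] [NormedSpace ℝ E] [FiniteDimensional ℝ E]
  [NormedAddCommGroup F] [NormedSpace ℝ F]

/-- An immersion is locally an embedding. -/
theorem HasStrictFDerivAt.exists_isEmbedding_of_injective {f : E → F} {f' : E →L[ℝ] F} {p : E}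
    (hf : HasStrictFDerivAt f f' p) (hf' : Function.Injective f') :
    ∃ U, IsOpen U ∧ p ∈ U ∧ Topology.IsEmbedding (U.domRestrict f) := by
  -- The injective derivative expands distances by at least K⁻¹. Near p the remainder f - f' has
  -- Lipschitz constant K⁻¹/2, too small to destroy this bound.
  obtain ⟨K, hK, hanti⟩ := (f' : E →ₗ[ℝ] F).exists_antilipschitzWith (LinearMap.ker_eq_bot.2 hf')
  have hpos : 0 < K⁻¹ / 2 := by positivity
  obtain ⟨s, hs, happ⟩ := hf.approximates_deriv_on_nhds (c := K⁻¹ / 2) (Or.inr hpos)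
  obtain ⟨U, hUs, hU, hpU⟩ := mem_nhds_iff.1 hs
  have happ' := happ.mono_set hUs
  have h1 : AntilipschitzWith (K⁻¹ - K⁻¹ / 2)⁻¹ (U.domRestrict f) := by
    convert! (AntilipschitzWith.domRestrict hanti U).add_lipschitzWith happ'.lipschitz_sub
      (NNReal.half_lt_self (by positivity))
    simp [Set.domRestrict]
  exact ⟨U, hU, hpU, (h1.isUniformEmbedding happ'.lipschitz.uniformContinuous).isEmbedding⟩

end Embedding

theorem IsAdaptedFrame.hasConstantPrincipalAngles {V : Set (EuclideanSpace ℝ (Fin 2))}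
    {X : EuclideanSpace ℝ (Fin 2) → EuclideanSpace ℝ (Fin 4)}
    {P : Submodule ℝ (EuclideanSpace ℝ (Fin 4))} {θ₁ θ₂ : ℝ}
    {e₁ e₂ n₁ n₂ : EuclideanSpace ℝ (Fin 2) → EuclideanSpace ℝ (Fin 4)}
    (h : IsAdaptedFrame V X P θ₁ θ₂ e₁ e₂ n₁ n₂) (h0 : 0 ≤ θ₁) (h12 : θ₁ ≤ θ₂)
    (hpi : θ₂ ≤ Real.pi / 2) : HasConstantPrincipalAngles V X P θ₁ θ₂ := by
  refine ⟨h.finrank_eq, fun p hp => ?_⟩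
  obtain ⟨i1, i2, i3⟩ := h.inner_tangent hp
  have i := h.inner_combination hp
  refine isPrincipalAngles_of_pairs h0 h12 hpi (finrank_tangentPlane (h.immersion p hp))
    h.finrank_eq (h.tangent₁ p hp) (h.tangent₂ p hp) (h.base.mem₁ p hp) (h.base.mem₂ p hp) i1 i2 i3
    (h.base.unit₁ p hp) (h.base.unit₂ p hp) (h.base.orth p hp) ?_ ?_ ?_ ?_
  · simpa using i (Real.cos θ₁) 0 (Real.sin θ₁) 0 1 0 0 0
  · simpa using i 0 (Real.cos θ₂) 0 (Real.sin θ₂) 0 1 0 0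
  · simpa using i (Real.cos θ₁) 0 (Real.sin θ₁) 0 0 1 0 0
  · simpa using i 0 (Real.cos θ₂) 0 (Real.sin θ₂) 1 0 0 0

/-! ### The explicit spiral surface -/

section Example

/-- The rotation of the vector `v` towards `w` by the angle `L q`. -/
noncomputable def rotatingField {G E : Type*} [NormedAddCommGroup G] [NormedSpace ℝ G]
    [NormedAddCommGroup E] [NormedSpace ℝ E] (L : G →L[ℝ] ℝ) (v w : E) (q : G) : E :=
  Real.cos (L q) • v + Real.sin (L q) • w

variable {G E : Type*} [NormedAddCommGroup G] [NormedSpace ℝ G] [NormedAddCommGroup E]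

theorem hasFDerivAt_rotatingField [NormedSpace ℝ E] (L : G →L[ℝ] ℝ) (v w : E) (q : G) :
    HasFDerivAt (rotatingField L v w) (L.smulRight (rotatingField L w (-v) q)) q := by
  have hc := (L.hasFDerivAt (x := q)).cos.smul_const v
  have hs := (L.hasFDerivAt (x := q)).sin.smul_const w
  refine (hc.add hs).congr_fderiv ?_
  ext a
  simp only [rotatingField, add_apply, ContinuousLinearMap.smulRight_apply, smul_apply, smul_eq_mul]
  module

theorem contDiff_rotatingField [NormedSpace ℝ E] (L : G →L[ℝ] ℝ) (v w : E) :
    ContDiff ℝ ∞ (rotatingField L v w) :=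
  (L.contDiff.cos.smul contDiff_const).add (L.contDiff.sin.smul contDiff_const)

theorem isOrthonormalPair_rotatingField [InnerProductSpace ℝ E] (L : G →L[ℝ] ℝ)
    {K : Submodule ℝ E} {v w : E} (hv : v ∈ K) (hw : w ∈ K) (hvv : ⟪v, v⟫ = 1) (hww : ⟪w, w⟫ = 1)
    (hvw : ⟪v, w⟫ = 0) :
    IsOrthonormalPair Set.univ K (rotatingField L v w) (rotatingField L w (-v)) := by
  have hwv : ⟪w, v⟫ = 0 := by rw [real_inner_comm]; exact hvw
  refine ⟨(contDiff_rotatingField L v w).contDiffOn, (contDiff_rotatingField L w (-v)).contDiffOn,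
    fun p _ => K.add_mem (K.smul_mem _ hv) (K.smul_mem _ hw),
    fun p _ => K.add_mem (K.smul_mem _ hw) (K.smul_mem _ (K.neg_mem hv)), fun p _ => ?_,
    fun p _ => ?_, fun p _ => ?_⟩ <;>
  · simp only [rotatingField, inner_add_left, inner_add_right, real_inner_smul_left,
      real_inner_smul_right, inner_neg_left, inner_neg_right, hvv, hww, hvw, hwv]
    nlinarith [Real.sin_sq_add_cos_sq (L p)]

end Example

section Example

/-- The linear functional `q ↦ x * q 0 + y * q 1`. -/
noncomputable def planeFunctional (x y : ℝ) : EuclideanSpace ℝ (Fin 2) →L[ℝ] ℝ :=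
  x • EuclideanSpace.proj 0 + y • EuclideanSpace.proj 1

@[simp]
theorem planeFunctional_apply (x y : ℝ) (q : EuclideanSpace ℝ (Fin 2)) :
    planeFunctional x y q = x * q 0 + y * q 1 := rfl

/-- The plane of the first two coordinates. -/
noncomputable def coordinatePlane : Submodule ℝ (EuclideanSpace ℝ (Fin 4)) :=
  Submodule.span ℝ {EuclideanSpace.single 0 1, EuclideanSpace.single 1 1}

theorem finrank_coordinatePlane : Module.finrank ℝ coordinatePlane = 2 := by
  have hli : LinearIndependent ℝ
      ![(EuclideanSpace.single 0 1 : EuclideanSpace ℝ (Fin 4)), EuclideanSpace.single 1 1] := by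
    rw [LinearIndependent.pair_iff]
    intro s t hst
    have h1 := congrArg (fun z : EuclideanSpace ℝ (Fin 4) => z 0) hst
    have h2 := congrArg (fun z : EuclideanSpace ℝ (Fin 4) => z 1) hst
    simp at h1 h2
    exact ⟨h1, h2⟩
  have := finrank_span_eq_card hli
  rwa [Matrix.range_cons, Matrix.range_cons, Matrix.range_empty, Set.union_empty,
    Set.singleton_union, Fintype.card_fin] at this

theorem single_mem_orthogonal_coordinatePlane {i : Fin 4} (h0 : i ≠ 0) (h1 : i ≠ 1) :
    EuclideanSpace.single i (1 : ℝ) ∈ coordinatePlaneᗮ := by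
  rw [Submodule.mem_orthogonal]
  intro u hu
  obtain ⟨a, b, rfl⟩ := Submodule.mem_span_pair.1 hu
  simp [inner_add_left, real_inner_smul_left, EuclideanSpace.inner_single_left, h0.symm, h1.symm]

/-- The example with constants `sᵢ = sin θᵢ`, `cᵢ = cos θᵢ`. -/
noncomputable def spiralSurface (s₁ c₁ s₂ c₂ : ℝ) (q : EuclideanSpace ℝ (Fin 2)) :
    EuclideanSpace ℝ (Fin 4) :=
  Real.exp (planeFunctional (s₁ * c₁) (-(s₂ * c₂)) q) •
    ((s₁ ^ 2 + s₂ ^ 2)⁻¹ •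
      (s₁ • rotatingField (planeFunctional (s₂ * c₁) (s₁ * c₂)) (EuclideanSpace.single 0 1)
          (EuclideanSpace.single 1 1) q -
        s₂ • rotatingField (planeFunctional (s₂ * c₁) (s₁ * c₂)) (EuclideanSpace.single 1 1)
          (-EuclideanSpace.single 0 1) q) +
    (c₁ ^ 2 + c₂ ^ 2)⁻¹ •
      (c₁ • rotatingField (planeFunctional (c₂ * s₁) (c₁ * s₂)) (EuclideanSpace.single 2 1)
          (EuclideanSpace.single 3 1) q -
        c₂ • rotatingField (planeFunctional (c₂ * s₁) (c₁ * s₂)) (EuclideanSpace.single 3 1)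
          (-EuclideanSpace.single 2 1) q))

theorem contDiff_spiralSurface (s₁ c₁ s₂ c₂ : ℝ) : ContDiff ℝ ∞ (spiralSurface s₁ c₁ s₂ c₂) := by
  have r := fun (L : EuclideanSpace ℝ (Fin 2) →L[ℝ] ℝ) (v w : EuclideanSpace ℝ (Fin 4)) =>
    contDiff_rotatingField L v w
  exact (planeFunctional _ _).contDiff.exp.smul
    ((((r _ _ _).const_smul _).sub ((r _ _ _).const_smul _)).const_smul _ |>.add
    ((((r _ _ _).const_smul _).sub ((r _ _ _).const_smul _)).const_smul _))

/-- Turns the derivative of the second rotating vector into a multiple of minus the first. -/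
theorem rotatingField_neg_neg {G E : Type*} [NormedAddCommGroup G] [NormedSpace ℝ G]
    [NormedAddCommGroup E] [NormedSpace ℝ E] (L : G →L[ℝ] ℝ) (v w : E) (q : G) :
    rotatingField L (-v) (-w) q = -rotatingField L v w q := by
  simp only [rotatingField]
  module

/-- The surface integrates ρ(T₁ du + T₂ dv). Constant forms A = (s₂c₁, s₁c₂) and B = (c₂s₁, c₁s₂)
satisfy the relations between connection forms, and closedness then forces d log ρ = (s₁c₁, -s₂c₂).
In complex notation each planar factor is an exponential; its primitive brings the coefficients
1/(s₁ + is₂) and 1/(c₁ + ic₂), whence the denominators. -/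
theorem fderiv_spiralSurface {s₁ c₁ s₂ c₂ : ℝ} (hs₁ : 0 < s₁) (hc₁ : 0 < c₁)
    (q a : EuclideanSpace ℝ (Fin 2)) :
    fderiv ℝ (spiralSurface s₁ c₁ s₂ c₂) q a =
      Real.exp (planeFunctional (s₁ * c₁) (-(s₂ * c₂)) q) •
      (a 0 • (c₁ • rotatingField (planeFunctional (s₂ * c₁) (s₁ * c₂)) (EuclideanSpace.single 0 1)
          (EuclideanSpace.single 1 1) q +
        s₁ • rotatingField (planeFunctional (c₂ * s₁) (c₁ * s₂)) (EuclideanSpace.single 2 1)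
          (EuclideanSpace.single 3 1) q) +
      a 1 • (c₂ • rotatingField (planeFunctional (s₂ * c₁) (s₁ * c₂)) (EuclideanSpace.single 1 1)
          (-EuclideanSpace.single 0 1) q +
        s₂ • rotatingField (planeFunctional (c₂ * s₁) (c₁ * s₂)) (EuclideanSpace.single 3 1)
          (-EuclideanSpace.single 2 1) q)) := by
  have r := fun (L : EuclideanSpace ℝ (Fin 2) →L[ℝ] ℝ) (v w : EuclideanSpace ℝ (Fin 4)) =>
    hasFDerivAt_rotatingField L v w q
  have hN : s₁ ^ 2 + s₂ ^ 2 ≠ 0 := by positivity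
  have hM : c₁ ^ 2 + c₂ ^ 2 ≠ 0 := by positivity
  have hd := (planeFunctional (s₁ * c₁) (-(s₂ * c₂))).hasFDerivAt (x := q) |>.exp.smul
    ((((r (planeFunctional (s₂ * c₁) (s₁ * c₂)) (EuclideanSpace.single 0 1)
      (EuclideanSpace.single 1 1)).const_smul s₁).sub
      ((r (planeFunctional (s₂ * c₁) (s₁ * c₂)) (EuclideanSpace.single 1 1)
        (-EuclideanSpace.single 0 1)).const_smul s₂)).const_smul (s₁ ^ 2 + s₂ ^ 2)⁻¹ |>.add
      ((((r (planeFunctional (c₂ * s₁) (c₁ * s₂)) (EuclideanSpace.single 2 1)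
      (EuclideanSpace.single 3 1)).const_smul c₁).sub
      ((r (planeFunctional (c₂ * s₁) (c₁ * s₂)) (EuclideanSpace.single 3 1)
        (-EuclideanSpace.single 2 1)).const_smul c₂)).const_smul (c₁ ^ 2 + c₂ ^ 2)⁻¹))
  have hd' : HasFDerivAt (spiralSurface s₁ c₁ s₂ c₂) _ q := hd
  rw [hd'.fderiv]
  simp only [rotatingField_neg_neg, add_apply, sub_apply, smul_apply,
    ContinuousLinearMap.smulRight_apply, Pi.add_apply, Pi.sub_apply, Pi.smul_apply,
    planeFunctional_apply, smul_eq_mul]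
  match_scalars <;> field_simp <;> ring

theorem fderiv_spiralSurface_single {s₁ c₁ s₂ c₂ : ℝ} (hs₁ : 0 < s₁) (hc₁ : 0 < c₁)
    (q : EuclideanSpace ℝ (Fin 2)) :
    fderiv ℝ (spiralSurface s₁ c₁ s₂ c₂) q
        ((Real.exp (planeFunctional (s₁ * c₁) (-(s₂ * c₂)) q))⁻¹ • EuclideanSpace.single 0 1) =
      c₁ • rotatingField (planeFunctional (s₂ * c₁) (s₁ * c₂)) (EuclideanSpace.single 0 1)
          (EuclideanSpace.single 1 1) q +
        s₁ • rotatingField (planeFunctional (c₂ * s₁) (c₁ * s₂)) (EuclideanSpace.single 2 1)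
          (EuclideanSpace.single 3 1) q ∧
    fderiv ℝ (spiralSurface s₁ c₁ s₂ c₂) q
        ((Real.exp (planeFunctional (s₁ * c₁) (-(s₂ * c₂)) q))⁻¹ • EuclideanSpace.single 1 1) =
      c₂ • rotatingField (planeFunctional (s₂ * c₁) (s₁ * c₂)) (EuclideanSpace.single 1 1)
          (-EuclideanSpace.single 0 1) q +
        s₂ • rotatingField (planeFunctional (c₂ * s₁) (c₁ * s₂)) (EuclideanSpace.single 3 1)
          (-EuclideanSpace.single 2 1) q := by
  rw [map_smul, map_smul, fderiv_spiralSurface hs₁ hc₁, fderiv_spiralSurface hs₁ hc₁,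
    inv_smul_smul₀ (Real.exp_pos _).ne', inv_smul_smul₀ (Real.exp_pos _).ne']
  simp

/-- Pairing with eᵢ removes the fibre part and isolates one coefficient; this gives the immersion
property of the example. -/
theorem IsOrthonormalPair.eq_zero_of_combination_eq_zero {G E : Type*} [NormedAddCommGroup G]
    [NormedSpace ℝ G] [NormedAddCommGroup E] [InnerProductSpace ℝ E] {V : Set G}
    {K : Submodule ℝ E} {e₁ e₂ n₁ n₂ : G → E} (base : IsOrthonormalPair V K e₁ e₂)
    (fibre : IsOrthonormalPair V Kᗮ n₁ n₂) {q : G} (hq : q ∈ V) {c₁ c₂ s₁ s₂ x y : ℝ}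
    (hc₁ : c₁ ≠ 0) (hc₂ : c₂ ≠ 0)
    (h : x • (c₁ • e₁ q + s₁ • n₁ q) + y • (c₂ • e₂ q + s₂ • n₂ q) = 0) : x = 0 ∧ y = 0 := by
  have o := fun u v hu hv => Submodule.inner_left_of_mem_orthogonal (K := K) (u := u) (v := v) hu hv
  have h1 := congrArg (fun z => ⟪z, e₁ q⟫) h
  have h2 := congrArg (fun z => ⟪z, e₂ q⟫) h
  simp only [inner_add_left, real_inner_smul_left, inner_zero_left] at h1 h2
  rw [base.unit₁ q hq, o _ _ (base.mem₁ q hq) (fibre.mem₁ q hq),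
    o _ _ (base.mem₁ q hq) (fibre.mem₂ q hq), real_inner_comm, base.orth q hq] at h1
  rw [base.unit₂ q hq, o _ _ (base.mem₂ q hq) (fibre.mem₁ q hq),
    o _ _ (base.mem₂ q hq) (fibre.mem₂ q hq), base.orth q hq] at h2
  exact ⟨(mul_eq_zero.1 (by linarith : x * c₁ = 0)).resolve_right hc₁,
    (mul_eq_zero.1 (by linarith : y * c₂ = 0)).resolve_right hc₂⟩

/-- The frame of the example. -/
theorem isAdaptedFrame_spiralSurface {θ₁ θ₂ : ℝ} (hs₁ : 0 < Real.sin θ₁) (hc₁ : 0 < Real.cos θ₁)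
    (hc₂ : 0 < Real.cos θ₂) :
    IsAdaptedFrame Set.univ
      (spiralSurface (Real.sin θ₁) (Real.cos θ₁) (Real.sin θ₂) (Real.cos θ₂)) coordinatePlane θ₁ θ₂
      (rotatingField (planeFunctional (Real.sin θ₂ * Real.cos θ₁) (Real.sin θ₁ * Real.cos θ₂))
        (EuclideanSpace.single 0 1) (EuclideanSpace.single 1 1))
      (rotatingField (planeFunctional (Real.sin θ₂ * Real.cos θ₁) (Real.sin θ₁ * Real.cos θ₂))
        (EuclideanSpace.single 1 1) (-EuclideanSpace.single 0 1))
      (rotatingField (planeFunctional (Real.cos θ₂ * Real.sin θ₁) (Real.cos θ₁ * Real.sin θ₂))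
        (EuclideanSpace.single 2 1) (EuclideanSpace.single 3 1))
      (rotatingField (planeFunctional (Real.cos θ₂ * Real.sin θ₁) (Real.cos θ₁ * Real.sin θ₂))
        (EuclideanSpace.single 3 1) (-EuclideanSpace.single 2 1)) := by
  have hD := fderiv_spiralSurface (s₂ := Real.sin θ₂) (c₂ := Real.cos θ₂) hs₁ hc₁
  have base := isOrthonormalPair_rotatingField (K := coordinatePlane)
    (planeFunctional (Real.sin θ₂ * Real.cos θ₁) (Real.sin θ₁ * Real.cos θ₂))
    (v := EuclideanSpace.single 0 1) (w := EuclideanSpace.single 1 1)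
    (Submodule.subset_span (by simp)) (Submodule.subset_span (by simp)) (by simp) (by simp)
    (by simp [EuclideanSpace.inner_single_left])
  have fibre := isOrthonormalPair_rotatingField (K := coordinatePlaneᗮ)
    (planeFunctional (Real.cos θ₂ * Real.sin θ₁) (Real.cos θ₁ * Real.sin θ₂))
    (v := EuclideanSpace.single 2 1) (w := EuclideanSpace.single 3 1)
    (single_mem_orthogonal_coordinatePlane (by decide) (by decide))
    (single_mem_orthogonal_coordinatePlane (by decide) (by decide)) (by simp) (by simp)
    (by simp [EuclideanSpace.inner_single_left])
  refine ⟨isOpen_univ, (contDiff_spiralSurface _ _ _ _).contDiffOn, fun q hq => ?_,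
    finrank_coordinatePlane, base, fibre, fun q _ => ?_, fun q _ => ?_⟩
  · refine (injective_iff_map_eq_zero _).2 fun a ha => ?_
    rw [hD, smul_eq_zero_iff_right (Real.exp_pos _).ne'] at ha
    obtain ⟨a0, a1⟩ := base.eq_zero_of_combination_eq_zero fibre hq hc₁.ne' hc₂.ne' ha
    ext i
    fin_cases i
    · exact a0
    · exact a1
  · exact ⟨_, (fderiv_spiralSurface_single hs₁ hc₁ q).1⟩
  · exact ⟨_, (fderiv_spiralSurface_single hs₁ hc₁ q).2⟩

theorem finrank_firstNormalSpace_spiralSurface {θ₁ θ₂ : ℝ} (hs₁ : 0 < Real.sin θ₁)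
    (hc₁ : 0 < Real.cos θ₁) (hc₂ : 0 < Real.cos θ₂) (hlt : Real.sin θ₁ < Real.sin θ₂)
    (p : EuclideanSpace ℝ (Fin 2)) :
    Module.finrank ℝ (firstNormalSpace
      (spiralSurface (Real.sin θ₁) (Real.cos θ₁) (Real.sin θ₂) (Real.cos θ₂)) p) = 2 := by
  have h := isAdaptedFrame_spiralSurface (θ₂ := θ₂) hs₁ hc₁ hc₂
  -- This number is sin² θ₁ - sin² θ₂; up to the factor ρ⁻¹ it is the value of both coefficients of
  -- the second fundamental form.
  have hneg : Real.sin θ₁ ^ 2 * Real.cos θ₂ ^ 2 - Real.cos θ₁ ^ 2 * Real.sin θ₂ ^ 2 ≠ 0 := by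
    rw [Real.cos_sq', Real.cos_sq']
    nlinarith
  refine (h.finrank_firstNormalSpace_eq_two_iff (Set.mem_univ p)
    (A := planeFunctional (Real.sin θ₂ * Real.cos θ₁) (Real.sin θ₁ * Real.cos θ₂))
    (B := planeFunctional (Real.cos θ₂ * Real.sin θ₁) (Real.cos θ₁ * Real.sin θ₂))
    (fun a => ?_) (fun a => ?_)
    (fderiv_spiralSurface_single hs₁ hc₁ p).1 (fderiv_spiralSurface_single hs₁ hc₁ p).2).2
    ⟨?_, ?_⟩
  · rw [(hasFDerivAt_rotatingField _ _ _ p).fderiv, (hasFDerivAt_rotatingField _ _ _ p).fderiv,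
      rotatingField_neg_neg]
    exact ⟨rfl, by simp only [ContinuousLinearMap.smulRight_apply, smul_neg, neg_smul]⟩
  · rw [(hasFDerivAt_rotatingField _ _ _ p).fderiv, (hasFDerivAt_rotatingField _ _ _ p).fderiv,
      rotatingField_neg_neg]
    exact ⟨rfl, by simp only [ContinuousLinearMap.smulRight_apply, smul_neg, neg_smul]⟩
  · rw [map_smul, map_smul]
    intro h0
    refine mul_ne_zero (inv_ne_zero (Real.exp_pos (planeFunctional (Real.sin θ₁ * Real.cos θ₁)
      (-(Real.sin θ₂ * Real.cos θ₂)) p)).ne') hneg (Eq.trans ?_ h0)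
    simp
    ring
  · rw [map_smul, map_smul]
    intro h0
    refine mul_ne_zero (inv_ne_zero (Real.exp_pos (planeFunctional (Real.sin θ₁ * Real.cos θ₁)
      (-(Real.sin θ₂ * Real.cos θ₂)) p)).ne') hneg (Eq.trans ?_ h0)
    simp
    ring

end Example

/-! ### The main theorem -/

theorem mainTheorem10 :
    (∀ θ₁ θ₂ : ℝ, 0 < θ₁ → θ₁ < θ₂ → θ₂ < Real.pi / 2 →
      ∃ (P : Submodule ℝ (EuclideanSpace ℝ (Fin 4))) (U : Set (EuclideanSpace ℝ (Fin 2)))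
        (X : EuclideanSpace ℝ (Fin 2) → EuclideanSpace ℝ (Fin 4)),
        IsImmersedSurface U X ∧ Topology.IsEmbedding (U.domRestrict X) ∧
        HasConstantPrincipalAngles U X P θ₁ θ₂ ∧
        ∀ p ∈ U, Module.finrank ℝ (firstNormalSpace X p) = 2) ∧
    (∀ θ₁ θ₂ : ℝ, 0 < θ₁ → θ₁ < θ₂ → θ₂ < Real.pi / 2 →
      ∀ (P : Submodule ℝ (EuclideanSpace ℝ (Fin 4))) (U : Set (EuclideanSpace ℝ (Fin 2)))
        (X : EuclideanSpace ℝ (Fin 2) → EuclideanSpace ℝ (Fin 4)),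
        IsImmersedSurface U X →
        HasConstantPrincipalAngles U X P θ₁ θ₂ →
        (∀ p ∈ U, Module.finrank ℝ (firstNormalSpace X p) = 2) →
        (∀ p ∈ U, ∃ V ⊆ U, IsOpen V ∧ p ∈ V ∧
          (∃ T₁, IsPrincipalField V X P θ₁ T₁) ∧ (∃ T₂, IsPrincipalField V X P θ₂ T₂)) ∧
        (∀ V ⊆ U, IsOpen V → V.Nonempty →
          (∀ T₁, IsPrincipalField V X P θ₁ T₁ → ¬ IsGeodesicField V X T₁) ∧
          (∀ T₂, IsPrincipalField V X P θ₂ T₂ → ¬ IsGeodesicField V X T₂)) ∧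
        (∀ V ⊆ U, IsOpen V → V.Nonempty → ¬ IsComposition V X)) := by
  constructor
  · intro θ₁ θ₂ h1 h12 h2
    have hs₁ : 0 < Real.sin θ₁ := Real.sin_pos_of_pos_of_lt_pi h1 (by linarith)
    have hc₁ : 0 < Real.cos θ₁ := Real.cos_pos_of_mem_Ioo ⟨by linarith, by linarith⟩
    have hc₂ : 0 < Real.cos θ₂ := Real.cos_pos_of_mem_Ioo ⟨by linarith, by linarith⟩
    have hlt : Real.sin θ₁ < Real.sin θ₂ :=
      Real.sin_lt_sin_of_lt_of_le_pi_div_two (by linarith) h2.le h12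
    have h := isAdaptedFrame_spiralSurface (θ₂ := θ₂) hs₁ hc₁ hc₂
    have hX := contDiff_spiralSurface (Real.sin θ₁) (Real.cos θ₁) (Real.sin θ₂) (Real.cos θ₂)
    have hstrict := hX.contDiffAt.hasStrictFDerivAt (x := 0) (by simp)
    -- The spiral surface is immersed on the whole plane; restricting it to a neighbourhood of 0
    -- makes it an embedding.
    obtain ⟨U, hU, h0, hemb⟩ := hstrict.exists_isEmbedding_of_injective
      (h.immersion 0 (Set.mem_univ _))
    have hangles := h.hasConstantPrincipalAngles h1.le h12.le h2.le
    exact ⟨coordinatePlane, U, _, ⟨hU, ⟨0, h0⟩, hX.contDiffOn,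
      fun p _ => h.immersion p (Set.mem_univ p)⟩, hemb,
      ⟨hangles.1, fun p _ => hangles.2 p (Set.mem_univ p)⟩,
      fun p _ => finrank_firstNormalSpace_spiralSurface hs₁ hc₁ hc₂ hlt p⟩
  · intro θ₁ θ₂ h1 h12 h2 P U X hX hangles hN
    have hs₁ : 0 < Real.sin θ₁ := Real.sin_pos_of_pos_of_lt_pi h1 (by linarith)
    have hc₁ : 0 < Real.cos θ₁ := Real.cos_pos_of_mem_Ioo ⟨by linarith, by linarith⟩
    have hs₂ : 0 < Real.sin θ₂ := Real.sin_pos_of_pos_of_lt_pi (by linarith) (by linarith)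
    have hc₂ : 0 < Real.cos θ₂ := Real.cos_pos_of_mem_Ioo ⟨by linarith, by linarith⟩
    have hcc : Real.cos θ₂ < Real.cos θ₁ :=
      Real.cos_lt_cos_of_nonneg_of_le_pi h1.le (by linarith) h12
    have hne : Real.cos θ₁ ^ 2 ≠ Real.cos θ₂ ^ 2 := (pow_lt_pow_left₀ hcc hc₂.le two_ne_zero).ne'
    have frame : ∀ {V}, V ⊆ U → IsOpen V → ∀ {T₁ T₂}, IsPrincipalField V X P θ₁ T₁ →
        IsPrincipalField V X P θ₂ T₂ → _ := fun {V} hVU hV {T₁ T₂} hT₁ hT₂ =>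
      IsPrincipalField.isAdaptedFrame hV (hX.smooth.mono hVU)
        (fun p hp => hX.immersion p (hVU hp)) hangles.1 hT₁ hT₂ hs₁.ne' hc₁.ne' hs₂.ne' hc₂.ne' hne
    have local_fields : ∀ {V}, V ⊆ U → IsOpen V → ∀ {p}, p ∈ V → ∃ V' ⊆ V, IsOpen V' ∧ p ∈ V' ∧
        (∃ T₁, IsPrincipalField V' X P θ₁ T₁) ∧ ∃ T₂, IsPrincipalField V' X P θ₂ T₂ :=
      fun {V} hVU hV {p} hp => HasConstantPrincipalAngles.exists_isPrincipalField
        ⟨hangles.1, fun q hq => hangles.2 q (hVU hq)⟩ hV (hX.smooth.mono hVU)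
        (fun q hq => hX.immersion q (hVU hq)) hne hp
    refine ⟨fun p hp => local_fields subset_rfl hX.isOpen hp, ?_, ?_⟩
    · rintro V hVU hV ⟨p, hp⟩
      -- A given field for one angle needs a partner for the other to form an adapted frame; the
      -- partner exists only locally, hence the smaller V'.
      obtain ⟨V', hV'V, hV', hp', ⟨S₁, hS₁⟩, S₂, hS₂⟩ := local_fields hVU hV hp
      constructor
      · intro T₁ hT₁ hgeo
        obtain ⟨e₁, e₂, n₁, n₂, h, hsum, -⟩ := frame (hV'V.trans hVU) hV' (hT₁.mono hV'V) hS₂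
        obtain ⟨t, -, ht, -⟩ := h.exists_coordinates hp'
        have hT : (fun q => Real.cos θ₁ • e₁ q + Real.sin θ₁ • n₁ q) = T₁ := funext hsum
        have := h.covariantDerivative_tangent₁_ne_zero hp' hs₁ hc₁ hs₂ hc₂ (hN p (hVU hp)) ht
        rw [hT] at this
        exact this (hgeo p hp t (by rw [ht, hsum]))
      · intro T₂ hT₂ hgeo
        obtain ⟨e₁, e₂, n₁, n₂, h, -, hsum⟩ := frame (hV'V.trans hVU) hV' hS₁ (hT₂.mono hV'V)
        obtain ⟨-, t, -, ht⟩ := h.exists_coordinates hp'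
        have hT : (fun q => Real.cos θ₂ • e₂ q + Real.sin θ₂ • n₂ q) = T₂ := funext hsum
        have := h.covariantDerivative_tangent₂_ne_zero hp' hs₁ hc₁ hs₂ hc₂ (hN p (hVU hp)) ht
        rw [hT] at this
        exact this (hgeo p hp t (by rw [ht, hsum]))
    · rintro V hVU hV ⟨p, hp⟩ ⟨W, g, F, hW, hg, hgW, hiso, hF, hFiso, hFg⟩
      obtain ⟨V', hV'V, hV', hp', ⟨S₁, hS₁⟩, S₂, hS₂⟩ := local_fields hVU hV hp
      obtain ⟨e₁, e₂, n₁, n₂, h, -⟩ := frame (hV'V.trans hVU) hV' hS₁ hS₂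
      exact h.not_isComposition hp' hs₁ hc₁ hs₂ hc₂ (fun q hq => hN q (hVU (hV'V hq)))
        ⟨W, g, F, hW, hg.mono hV'V, hgW.mono_left hV'V, fun q hq => hiso q (hV'V hq), hF, hFiso,
          hFg.mono hV'V⟩
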